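/- Let $\mathbb{K}$ be a field of characteristic $0$ and let $S=\mathbb{K}[x_1,\dots,x_l]$ with the standard grading. For a graded $\mathbb{K}$-algebra $R=\bigoplus_{i\ge 0}R_i$ with finite-dimensional components, an element $\ell\in R_1$ is a strong (respectively weak) Lefschetz element of $R$ if the multiplication map $\times \ell^s\colon R_i\to R_{i+s}$ has full rank (that is, is injective or surjective) for all $i\ge 0$ and all $s\ge 1$ (respectively for all $i\ge 0$ and $s=1$). For $k\ge 1$, the algebra $R$ has the $k$-SLP (respectively the $k$-WLP) if there are $\ell_1,\dots,\ell_k\in R_1$ such that, for every $i=1,\dots,k$, the class of $\ell_i$ is a strong (respectively weak) Lefschetz element of $R/\langle \ell_1,\dots,\ell_{i-1}\rangle$. For a homogeneous ideal $I\ne 0$ of $S$ with graded Betti numbers $\beta_{i,j}(I)$ (the number of generators of degree $j$ in the $i$-th module of a minimal graded free resolution of $I$), the Castelnuovo–Mumford regularity is $\operatorname{reg}(I)=\max\{j-i \mid \beta_{i,j}(I)\neq 0\}$; we put $\operatorname{reg}(0)=0$. Let $I$ be a homogeneous ideal of $S$, let $1\le k\le l$, and set $$\hat I = I+\langle x_1,\dots,x_l\rangle^{\operatorname{reg}(I)+1}.$$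 Then the graded ring $S/\hat I$ is Artinian; $S/I$ has the $k$-SLP if and only if $S/\hat I$ has the $k$-SLP; and $S/I$ has the $k$-WLP if and only if $S/\hat I$ has the $k$-WLP. -/

import Mathlib

open MvPolynomial

attribute [local instance] MvPolynomial.gradedAlgebra

/-! ### Lefschetz properties of graded algebras -/

section Lefschetz

variable {K R : Type*} [Field K] [CommRing R] [Algebra K R]

/-- Multiplication by `f`, as a map from the component `𝒜 i` to the component `𝒜 j`, has full rank.
The components of the algebras considered here are finite-dimensional over `K`, so a linear map
between them has maximal rank if and only if it is injective or surjective. -/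
def MulFullRank (𝒜 : ℕ → Submodule K R) (f : R) (i j : ℕ) : Prop :=
  Set.InjOn (fun r => f * r) (𝒜 i : Set R) ∨
    Set.SurjOn (fun r => f * r) (𝒜 i : Set R) (𝒜 j : Set R)

/-- `ℓ` is a weak Lefschetz element of the graded algebra `R = ⨁ 𝒜 i`. -/
def IsWeakLefschetzElement (𝒜 : ℕ → Submodule K R) (ℓ : R) : Prop :=
  ℓ ∈ 𝒜 1 ∧ ∀ i, MulFullRank 𝒜 ℓ i (i + 1)

/-- `ℓ` is a strong Lefschetz element of the graded algebra `R = ⨁ 𝒜 i`. -/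
def IsStrongLefschetzElement (𝒜 : ℕ → Submodule K R) (ℓ : R) : Prop :=
  ℓ ∈ 𝒜 1 ∧ ∀ i s, 1 ≤ s → MulFullRank 𝒜 (ℓ ^ s) i (i + s)

/-- The graded components of `R ⧸ J`, for a homogeneous ideal `J`: the images of the components
of `R`. -/
def quotientGrading (𝒜 : ℕ → Submodule K R) (J : Ideal R) (i : ℕ) : Submodule K (R ⧸ J) :=
  (𝒜 i).map (Ideal.Quotient.mkₐ K J).toLinearMap

/-- `(R, ℓ₁, …, ℓₖ)` has the `k`-WLP: the `ℓᵢ` are linear and the class of `ℓᵢ` is a weak Lefschetz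
element of `R ⧸ (ℓ₁, …, ℓᵢ₋₁)` for all `i` (for the first index this is `R ⧸ (0) = R`). -/
def HasKWLPWith (𝒜 : ℕ → Submodule K R) {k : ℕ} (ℓ : Fin k → R) : Prop :=
  ∀ i : Fin k, ℓ i ∈ 𝒜 1 ∧
    IsWeakLefschetzElement (quotientGrading 𝒜 (Ideal.span {x | ∃ j < i, ℓ j = x}))
      (Ideal.Quotient.mk _ (ℓ i))

/-- `(R, ℓ₁, …, ℓₖ)` has the `k`-SLP: the `ℓᵢ` are linear and the class of `ℓᵢ` is a strong
Lefschetz element of `R ⧸ (ℓ₁, …, ℓᵢ₋₁)` for all `i` (for the first index this is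
`R ⧸ (0) = R`). -/
def HasKSLPWith (𝒜 : ℕ → Submodule K R) {k : ℕ} (ℓ : Fin k → R) : Prop :=
  ∀ i : Fin k, ℓ i ∈ 𝒜 1 ∧
    IsStrongLefschetzElement (quotientGrading 𝒜 (Ideal.span {x | ∃ j < i, ℓ j = x}))
      (Ideal.Quotient.mk _ (ℓ i))

/-- The graded algebra `R = ⨁ 𝒜 i` has the `k`-WLP. -/
def HasKWLP (𝒜 : ℕ → Submodule K R) (k : ℕ) : Prop :=
  ∃ ℓ : Fin k → R, HasKWLPWith 𝒜 ℓ

/-- The graded algebra `R = ⨁ 𝒜 i` has the `k`-SLP. -/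
def HasKSLP (𝒜 : ℕ → Submodule K R) (k : ℕ) : Prop :=
  ∃ ℓ : Fin k → R, HasKSLPWith 𝒜 ℓ

end Lefschetz

/-! ### Minimal graded free resolutions, graded Betti numbers, regularity -/

section Regularity

variable {K : Type*} [Field K] {l : ℕ}

/-- The vector `v` is homogeneous of degree `t` in the graded free module `⨁ₐ S(-e a)`, whose
`a`-th basis vector has degree `e a`. -/
def IsHomogeneousVector {n : ℕ} (e : Fin n → ℕ) (t : ℕ)
    (v : Fin n → MvPolynomial (Fin l) K) : Prop :=
  ∀ a u, coeff u (v a) ≠ 0 → u.degree + e a = t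

/-- A minimal graded free resolution `⋯ → F₁ → F₀ → I → 0` of the ideal `I` of
`S = K[x₁, …, x_l]`: `Fᵢ` is the free module with basis `Fin (rank i)`, the `a`-th basis vector
having degree `deg i a`; all maps are homogeneous of degree `0`, the complex is exact, and
`d(Fᵢ₊₁) ⊆ (x₁, …, x_l) Fᵢ`. -/
structure MinimalGradedFreeResolution (I : Ideal (MvPolynomial (Fin l) K)) where
  rank : ℕ → ℕ
  deg : ∀ i, Fin (rank i) → ℕ
  d : ∀ i, (Fin (rank (i + 1)) → MvPolynomial (Fin l) K) →ₗ[MvPolynomial (Fin l) K]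
    (Fin (rank i) → MvPolynomial (Fin l) K)
  aug : (Fin (rank 0) → MvPolynomial (Fin l) K) →ₗ[MvPolynomial (Fin l) K] MvPolynomial (Fin l) K
  aug_homogeneous : ∀ a, (aug (Pi.single a 1)).IsHomogeneous (deg 0 a)
  d_homogeneous : ∀ i b, IsHomogeneousVector (deg i) (deg (i + 1) b) (d i (Pi.single b 1))
  range_aug : LinearMap.range aug = I
  exact_zero : LinearMap.range (d 0) = LinearMap.ker aug
  exact_succ : ∀ i, LinearMap.range (d (i + 1)) = LinearMap.ker (d i)
  minimal : ∀ i v a, constantCoeff (d i v a) = 0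

/-- The number of basis vectors of degree `j` in the `i`-th module of the resolution. -/
def MinimalGradedFreeResolution.betti {I : Ideal (MvPolynomial (Fin l) K)}
    (F : MinimalGradedFreeResolution I) (i j : ℕ) : ℕ :=
  (Finset.univ.filter fun a => F.deg i a = j).card

/-! Every homogeneous ideal has a minimal graded free resolution. -/

/-- The homogeneous component of degree `t` of a vector in `⨁ₐ S(-e a)`. -/
noncomputable def vectorComponent {n : ℕ} (e : Fin n → ℕ) (t : ℕ) :
    (Fin n → MvPolynomial (Fin l) K) →ₗ[K] (Fin n → MvPolynomial (Fin l) K) :=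
  LinearMap.pi fun a =>
    (if e a ≤ t then homogeneousComponent (t - e a) else 0) ∘ₗ LinearMap.proj a

theorem coeff_vectorComponent {n : ℕ} (e : Fin n → ℕ) (t : ℕ)
    (v : Fin n → MvPolynomial (Fin l) K) (a : Fin n) (u : Fin l →₀ ℕ) :
    coeff u (vectorComponent e t v a) = if u.degree + e a = t then coeff u (v a) else 0 := by
  simp only [vectorComponent, LinearMap.pi_apply, LinearMap.comp_apply, LinearMap.proj_apply]
  by_cases h : e a ≤ t
  · simp only [h, if_true, coeff_homogeneousComponent]
    congr 1
    exact propext ⟨fun h1 => by omega, fun h1 => by omega⟩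
  · rw [if_neg h, if_neg (by omega)]
    simp

theorem isHomogeneousVector_component {n : ℕ} (e : Fin n → ℕ) (t : ℕ)
    (v : Fin n → MvPolynomial (Fin l) K) : IsHomogeneousVector e t (vectorComponent e t v) := by
  intro a u h
  rw [coeff_vectorComponent] at h
  by_contra h1
  simp [h1] at h

theorem vectorComponent_of_homogeneous {n : ℕ} {e : Fin n → ℕ} {s : ℕ}
    {v : Fin n → MvPolynomial (Fin l) K} (hv : IsHomogeneousVector e s v) (t : ℕ) :
    vectorComponent e t v = if s = t then v else 0 := by
  funext a
  ext u
  rw [coeff_vectorComponent]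
  by_cases h0 : coeff u (v a) = 0
  · split_ifs <;> simp [h0]
  · rw [hv a u h0]
    split_ifs <;> simp

theorem exists_sum_vectorComponent {n : ℕ} (e : Fin n → ℕ)
    (v : Fin n → MvPolynomial (Fin l) K) :
    ∃ T₀, ∀ T, T₀ ≤ T → ∑ t ∈ Finset.range T, vectorComponent e t v = v := by
  classical
  refine ⟨(Finset.univ.sup fun a => (v a).totalDegree + e a) + 1, fun T hT => ?_⟩
  funext a
  ext u
  rw [Finset.sum_apply, coeff_sum]
  simp only [coeff_vectorComponent]
  rw [Finset.sum_ite_eq]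
  split_ifs with h
  · rfl
  · by_contra h0
    apply h
    have h1 : u.degree ≤ (v a).totalDegree :=
      le_totalDegree (mem_support_iff.2 (Ne.symm h0))
    have h2 : (v a).totalDegree + e a ≤ Finset.univ.sup fun a => (v a).totalDegree + e a :=
      Finset.le_sup (f := fun a => (v a).totalDegree + e a) (Finset.mem_univ a)
    rw [Finset.mem_range]
    omega

/-- The homogeneous vectors `g b` of degree `e' b` define a degree `0` map. -/
theorem isHomogeneousVector_map {n m : ℕ} {e : Fin n → ℕ} {e' : Fin m → ℕ}
    {g : Fin m → Fin n → MvPolynomial (Fin l) K} (hg : ∀ b, IsHomogeneousVector e (e' b) (g b))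
    {t : ℕ} {v : Fin m → MvPolynomial (Fin l) K} (hv : IsHomogeneousVector e' t v) :
    IsHomogeneousVector e t (Fintype.linearCombination (MvPolynomial (Fin l) K) g v) := by
  classical
  intro a u hu
  rw [Fintype.linearCombination_apply, Finset.sum_apply, coeff_sum] at hu
  obtain ⟨b, -, hb⟩ := Finset.exists_ne_zero_of_sum_ne_zero hu
  rw [Pi.smul_apply, smul_eq_mul, coeff_mul] at hb
  obtain ⟨p, hp, hpb⟩ := Finset.exists_ne_zero_of_sum_ne_zero hb
  have h1 := hv b p.1 (left_ne_zero_of_mul hpb)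
  have h2 := hg b a p.2 (right_ne_zero_of_mul hpb)
  rw [← Finset.HasAntidiagonal.mem_antidiagonal.1 hp, map_add]
  omega

theorem map_vectorComponent {n m : ℕ} {e : Fin n → ℕ} {e' : Fin m → ℕ}
    {g : Fin m → Fin n → MvPolynomial (Fin l) K} (hg : ∀ b, IsHomogeneousVector e (e' b) (g b))
    (t : ℕ) (v : Fin m → MvPolynomial (Fin l) K) :
    Fintype.linearCombination (MvPolynomial (Fin l) K) g (vectorComponent e' t v) =
      vectorComponent e t (Fintype.linearCombination (MvPolynomial (Fin l) K) g v) := by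
  obtain ⟨T₀, hT⟩ := exists_sum_vectorComponent e' v
  have h := hT (max T₀ (t + 1)) (le_max_left _ _)
  conv_rhs => rw [← h, map_sum, map_sum]
  rw [Finset.sum_congr rfl fun s _ => vectorComponent_of_homogeneous
    (isHomogeneousVector_map hg (isHomogeneousVector_component e' s v)) t]
  rw [Finset.sum_ite_eq', if_pos]
  exact Finset.mem_range.2 (lt_of_lt_of_le (Nat.lt_succ_self t) (le_max_right _ _))

/-- A graded submodule of `⨁ₐ S(-e a)`. -/
def IsGradedSubmodule {n : ℕ} (e : Fin n → ℕ)
    (N : Submodule (MvPolynomial (Fin l) K) (Fin n → MvPolynomial (Fin l) K)) : Prop :=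
  ∀ v ∈ N, ∀ t, vectorComponent e t v ∈ N

theorem isGradedSubmodule_ker {n m : ℕ} {e : Fin n → ℕ} {e' : Fin m → ℕ}
    {g : Fin m → Fin n → MvPolynomial (Fin l) K} (hg : ∀ b, IsHomogeneousVector e (e' b) (g b)) :
    IsGradedSubmodule e'
      (LinearMap.ker (Fintype.linearCombination (MvPolynomial (Fin l) K) g)) := by
  intro v hv t
  rw [LinearMap.mem_ker] at hv ⊢
  rw [map_vectorComponent hg, hv, map_zero]

theorem exists_homogeneous_generators {n : ℕ} (e : Fin n → ℕ)
    (N : Submodule (MvPolynomial (Fin l) K) (Fin n → MvPolynomial (Fin l) K))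
    (hN : IsGradedSubmodule e N) :
    ∃ (m : ℕ) (g : Fin m → Fin n → MvPolynomial (Fin l) K) (e' : Fin m → ℕ),
      (∀ b, IsHomogeneousVector e (e' b) (g b)) ∧
        Submodule.span (MvPolynomial (Fin l) K) (Set.range g) = N := by
  classical
  obtain ⟨G, hG⟩ := IsNoetherian.noetherian N
  choose T hT using fun v : Fin n → MvPolynomial (Fin l) K => exists_sum_vectorComponent e v
  let A : Finset ((Fin n → MvPolynomial (Fin l) K) × ℕ) :=
    G.biUnion fun v => (Finset.range (T v)).image fun t => (v, t)
  let φ : Fin A.card ≃ A := A.equivFin.symm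
  refine ⟨A.card, fun b => vectorComponent e (φ b).1.2 (φ b).1.1, fun b => (φ b).1.2,
    fun b => isHomogeneousVector_component _ _ _, le_antisymm ?_ ?_⟩
  · rw [Submodule.span_le]
    rintro _ ⟨b, rfl⟩
    refine hN _ ?_ _
    have h1 : (φ b).1.1 ∈ G := by
      have h2 := (φ b).2
      simp only [A, Finset.mem_biUnion, Finset.mem_image] at h2
      obtain ⟨v, hv, t, -, ht⟩ := h2
      rw [← ht]
      exact hv
    rw [← hG]
    exact Submodule.subset_span h1
  · conv_lhs => rw [← hG]
    rw [Submodule.span_le]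
    intro v hv
    have h1 := hT v (T v) le_rfl
    rw [SetLike.mem_coe, ← h1]
    refine Submodule.sum_mem _ fun t ht => Submodule.subset_span ?_
    have h2 : (v, t) ∈ A :=
      Finset.mem_biUnion.2 ⟨v, hv, Finset.mem_image.2 ⟨t, ht, rfl⟩⟩
    exact ⟨φ.symm ⟨(v, t), h2⟩, by simp⟩

/-- A graded submodule has a homogeneous system of generators whose relations all have coefficients
without constant term. -/
theorem exists_minimal_generators {n : ℕ} (e : Fin n → ℕ)
    (N : Submodule (MvPolynomial (Fin l) K) (Fin n → MvPolynomial (Fin l) K))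
    (hN : IsGradedSubmodule e N) :
    ∃ (m : ℕ) (g : Fin m → Fin n → MvPolynomial (Fin l) K) (e' : Fin m → ℕ),
      (∀ b, IsHomogeneousVector e (e' b) (g b)) ∧
        LinearMap.range (Fintype.linearCombination (MvPolynomial (Fin l) K) g) = N ∧
        ∀ v, Fintype.linearCombination (MvPolynomial (Fin l) K) g v = 0 →
          ∀ b, constantCoeff (v b) = 0 := by
  classical
  have hex := exists_homogeneous_generators e N hN
  obtain ⟨g, e', hg, hspan⟩ := Nat.find_spec hex
  have hmin := fun m => Nat.find_min hex (m := m)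
  generalize Nat.find hex = M at *
  refine ⟨M, g, e', hg, by rw [Fintype.range_linearCombination, hspan], ?_⟩
  intro v hv b
  by_contra hc
  have hker := isGradedSubmodule_ker hg v (LinearMap.mem_ker.2 hv) (e' b)
  rw [LinearMap.mem_ker] at hker
  set w := vectorComponent e' (e' b) v with hw
  have hwb : w b = C (constantCoeff (v b)) := by
    ext u
    rw [hw, coeff_vectorComponent, coeff_C, constantCoeff_eq]
    by_cases hu : 0 = u
    · subst hu
      simp
    · have hu' : u.degree ≠ 0 := fun h => hu ((Finsupp.degree_eq_zero_iff u).1 h).symm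
      rw [if_neg (by omega), if_neg hu]
  obtain ⟨m, rfl⟩ : ∃ m, M = m + 1 := ⟨M - 1, by have := b.2; omega⟩
  refine hmin m (Nat.lt_succ_self m) ⟨fun a => g (b.succAbove a), fun a => e' (b.succAbove a),
    fun a => hg _, le_antisymm ?_ ?_⟩
  · rw [← hspan]
    refine Submodule.span_mono ?_
    rintro _ ⟨a, rfl⟩
    exact ⟨_, rfl⟩
  · conv_lhs => rw [← hspan]
    rw [Submodule.span_le]
    have hothers : ∀ a, g (b.succAbove a) ∈ Submodule.span (MvPolynomial (Fin l) K)
        (Set.range fun a => g (b.succAbove a)) := fun a => Submodule.subset_span ⟨a, rfl⟩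
    rintro _ ⟨a, rfl⟩
    rcases eq_or_ne a b with rfl | hab
    · rw [Fintype.linearCombination_apply, Fin.sum_univ_succAbove _ a, hwb] at hker
      have h1 : (C (constantCoeff (v a))⁻¹ : MvPolynomial (Fin l) K) •
          (C (constantCoeff (v a)) : MvPolynomial (Fin l) K) • g a = g a := by
        rw [smul_smul, ← C_mul, inv_mul_cancel₀ hc, C_1, one_smul]
      rw [SetLike.mem_coe, ← h1, eq_neg_of_add_eq_zero_left hker]
      exact Submodule.smul_mem _ _ (Submodule.neg_mem _ (Submodule.sum_mem _ fun c _ =>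
        Submodule.smul_mem _ _ (hothers c)))
    · obtain ⟨c, rfl⟩ := Fin.exists_succAbove_eq hab
      exact hothers c

/-- A graded submodule of a graded free module, one stage in the construction of a resolution. -/
structure SyzygyStage (K : Type*) [Field K] (l : ℕ) where
  n : ℕ
  e : Fin n → ℕ
  N : Submodule (MvPolynomial (Fin l) K) (Fin n → MvPolynomial (Fin l) K)
  graded : IsGradedSubmodule e N

namespace SyzygyStage

/-- The number of chosen minimal generators. -/
noncomputable def m (Z : SyzygyStage K l) : ℕ :=
  (exists_minimal_generators Z.e Z.N Z.graded).choose

/-- The chosen minimal generators. -/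
noncomputable def g (Z : SyzygyStage K l) : Fin Z.m → Fin Z.n → MvPolynomial (Fin l) K :=
  (exists_minimal_generators Z.e Z.N Z.graded).choose_spec.choose

/-- The degrees of the chosen minimal generators. -/
noncomputable def e' (Z : SyzygyStage K l) : Fin Z.m → ℕ :=
  (exists_minimal_generators Z.e Z.N Z.graded).choose_spec.choose_spec.choose

theorem spec (Z : SyzygyStage K l) :
    (∀ b, IsHomogeneousVector Z.e (Z.e' b) (Z.g b)) ∧
      LinearMap.range (Fintype.linearCombination (MvPolynomial (Fin l) K) Z.g) = Z.N ∧
      ∀ v, Fintype.linearCombination (MvPolynomial (Fin l) K) Z.g v = 0 →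
        ∀ b, constantCoeff (v b) = 0 :=
  (exists_minimal_generators Z.e Z.N Z.graded).choose_spec.choose_spec.choose_spec

theorem homogeneous_single (Z : SyzygyStage K l) (b : Fin Z.m) :
    IsHomogeneousVector Z.e (Z.e' b)
      (Fintype.linearCombination (MvPolynomial (Fin l) K) Z.g (Pi.single b 1)) := by
  classical
  rw [Fintype.linearCombination_apply_single, one_smul]
  exact Z.spec.1 b

/-- The module of syzygies of the chosen generators. -/
noncomputable def next (Z : SyzygyStage K l) : SyzygyStage K l where
  n := Z.m
  e := Z.e'
  N := LinearMap.ker (Fintype.linearCombination (MvPolynomial (Fin l) K) Z.g)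
  graded := isGradedSubmodule_ker Z.spec.1

/-- The sequence of syzygy modules. -/
noncomputable def seq (Z : SyzygyStage K l) : ℕ → SyzygyStage K l
  | 0 => Z
  | i + 1 => (Z.seq i).next

end SyzygyStage

theorem exists_minimalGradedFreeResolution {I : Ideal (MvPolynomial (Fin l) K)}
    (hI : I.IsHomogeneous (homogeneousSubmodule (Fin l) K)) :
    Nonempty (MinimalGradedFreeResolution I) := by
  classical
  let π : (Fin 1 → MvPolynomial (Fin l) K) →ₗ[MvPolynomial (Fin l) K] MvPolynomial (Fin l) K :=
    LinearMap.proj 0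
  have hπ : Function.Injective π := by
    intro v w h
    funext a
    rw [Subsingleton.elim a 0]
    exact h
  let Z : SyzygyStage K l :=
    { n := 1
      e := fun _ => 0
      N := Submodule.comap π I
      graded := by
        intro v hv t
        have h1 : π (vectorComponent (fun _ => 0) t v) = homogeneousComponent t (v 0) := by
          ext u
          change coeff u (vectorComponent (fun _ => 0) t v 0) = _
          rw [coeff_vectorComponent, coeff_homogeneousComponent]
          simp
        rw [Submodule.mem_comap, h1]
        exact homogeneousComponent_mem_of_mem hI hv t }
  have hπs : LinearMap.range π = ⊤ :=
    LinearMap.range_eq_top.2 fun p => ⟨fun _ => p, rfl⟩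
  refine ⟨{
    rank := fun i => (Z.seq i).m
    deg := fun i => (Z.seq i).e'
    d := fun i => Fintype.linearCombination (MvPolynomial (Fin l) K) (Z.seq (i + 1)).g
    aug := π ∘ₗ Fintype.linearCombination (MvPolynomial (Fin l) K) Z.g
    aug_homogeneous := ?_
    d_homogeneous := ?_
    range_aug := ?_
    exact_zero := ?_
    exact_succ := ?_
    minimal := ?_ }⟩
  · intro a
    intro u hu
    have h1 : u.degree + 0 = Z.e' a := Z.homogeneous_single a 0 u hu
    have h2 : Finsupp.weight (1 : Fin l → ℕ) u = u.degree := by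
      rw [Finsupp.degree_eq_weight_one]
      rfl
    exact h2.trans h1
  · intro i b
    exact (Z.seq (i + 1)).homogeneous_single b
  · refine (LinearMap.range_comp _ _).trans ?_
    refine (congrArg (Submodule.map π) Z.spec.2.1).trans ?_
    exact Submodule.map_comap_eq_of_surjective (LinearMap.range_eq_top.1 hπs) I
  · refine Eq.trans ?_ (LinearMap.ker_comp_of_ker_eq_bot _ (LinearMap.ker_eq_bot.2 hπ)).symm
    exact (Z.seq 1).spec.2.1
  · intro i
    exact (Z.seq (i + 2)).spec.2.1
  · intro i v a
    have h1 : Fintype.linearCombination (MvPolynomial (Fin l) K) (Z.seq (i + 1)).g v ∈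
        (Z.seq (i + 1)).N := by
      rw [← (Z.seq (i + 1)).spec.2.1]
      exact ⟨v, rfl⟩
    exact (Z.seq i).spec.2.2 _ h1 a

/-- The graded Betti number `β_{i,j}(I)` of a homogeneous ideal `I`, read off from a minimal graded
free resolution (which is unique up to isomorphism). -/
noncomputable def gradedBetti (I : Ideal (MvPolynomial (Fin l) K))
    (hI : I.IsHomogeneous (homogeneousSubmodule (Fin l) K)) (i j : ℕ) : ℕ :=
  (Classical.choice (exists_minimalGradedFreeResolution hI)).betti i j

/-- The Castelnuovo-Mumford regularity of a homogeneous ideal `I`: the maximum of the numbers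
`j - i` with `β_{i,j}(I) ≠ 0`. For `I ≠ 0` some `β_{0,j}(I)` with `j ≥ 0` is nonzero, so that the
maximum is a natural number and only pairs with `j ≥ i` matter; `reg(0) = 0` by convention. -/
noncomputable def castelnuovoMumfordRegularity (I : Ideal (MvPolynomial (Fin l) K))
    (hI : I.IsHomogeneous (homogeneousSubmodule (Fin l) K)) : ℕ :=
  sSup {r : ℕ | ∃ i j, gradedBetti I hI i j ≠ 0 ∧ j = i + r}

/-- The ideal `Î = I + (x₁, …, x_l)^(reg(I) + 1)`. -/
noncomputable def hatIdeal (I : Ideal (MvPolynomial (Fin l) K))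
    (hI : I.IsHomogeneous (homogeneousSubmodule (Fin l) K)) : Ideal (MvPolynomial (Fin l) K) :=
  I ⊔ Ideal.span (Set.range X) ^ (castelnuovoMumfordRegularity I hI + 1)

end Regularity

/-! Write `r = reg I`, `𝔪` for the ideal of the variables and `Jᵢ` for the ideal generated by `I`
and the first `i` linear forms. Passing from `S/I` to `S/Î` changes nothing in degrees up to `r` and
kills everything above. Hence a Lefschetz property of `S/Î` is the full rank condition on `S/I` for
the maps ending in degree at most `r` (`fullRank_sup_pow_iff`), and one implication holds with the
same linear forms. For the converse the forms may have to be changed. Three facts carry it.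

Openness: only finitely many dimensions occur in degrees up to `r`, so the condition survives for
all but finitely many members of a polynomial family of sequences
(`finite_setOf_not_isLefschetzUpTo`). Over an infinite field the terms can therefore be moved one at
a time until the first `l` of them are a basis of the linear forms and each is filter regular, that
is, injective in large degrees modulo `I` and its predecessors (`exists_generic_isLefschetzUpTo`).

Regularity: for such a sequence the injectivity already starts in degree `r`
(`mem_of_mul_mem_of_regularity_le`). Dimension shifting along the minimal resolution shows that the
Koszul homology `Hᵢ` of all `l` forms on `S/I` vanishes for `i ≥ 1` in internal degrees at least `r
+ i`. Now remove the forms one by one. The Koszul complex of `p + 1` forms is the cone of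
multiplication by the last one on the complex of `p` forms, so vanishing for `p + 1` forms gives
injectivity on the homology for `p` forms. Combined with vanishing in large degrees, which filter
regularity provides, this gives the vanishing for `p` forms. On `H₀ = S/J_p` the injectivity is the
assertion.

Extension: if multiplication by `f` on `S/J` is injective from degree `r` on, then full rank up to
degree `r` implies full rank everywhere (`fullRank_of_injective`). -/

/-! ### Koszul complexes of graded modules -/

section Koszul

universe u

/-- A module with a family of additive subgroups indexed by the integers, such that multiplication
by the elements of `V` raises the index by one. -/
structure GradedMod (S : Type u) [CommRing S] (V : Set S) where
  X : Type u
  [addCommGroup : AddCommGroup X]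
  [module : Module S X]
  piece : ℤ → AddSubgroup X
  smul_mem : ∀ f ∈ V, ∀ t, ∀ x ∈ piece t, f • x ∈ piece (t + 1)

attribute [instance] GradedMod.addCommGroup GradedMod.module

/-- A complex of modules, written as one module with a differential. The subgroup `gr i t` holds the
elements of homological degree `i` and internal degree `t + i`. -/
structure GradedComplex (S : Type u) [CommRing S] (V : Set S) where
  X : Type u
  [addCommGroup : AddCommGroup X]
  [module : Module S X]
  d : X →ₗ[S] X
  gr : ℕ → ℤ → AddSubgroup X
  smul_mem : ∀ f ∈ V, ∀ i t, ∀ x ∈ gr i t, f • x ∈ gr i (t + 1)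
  d_mem : ∀ i t, ∀ x ∈ gr (i + 1) t, d x ∈ gr i (t + 1)
  d_zero : ∀ t, ∀ x ∈ gr 0 t, d x = 0
  d_d : ∀ x, d (d x) = 0

attribute [instance] GradedComplex.addCommGroup GradedComplex.module

variable {S : Type u} [CommRing S] {V : Set S}

/-! ### Mapping cones and the long exact sequence of homology -/

namespace GradedComplex

/-- The homology of the complex vanishes in bidegree `(i, t)`. -/
def ExactAt (C : GradedComplex S V) (i : ℕ) (t : ℤ) : Prop :=
  ∀ z ∈ C.gr i t, C.d z = 0 → ∃ w ∈ C.gr (i + 1) (t - 1), C.d w = z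

/-- Multiplication by `f` is injective on the homology in bidegree `(i, t)`. -/
def InjectiveAt (C : GradedComplex S V) (f : S) (i : ℕ) (t : ℤ) : Prop :=
  ∀ b ∈ C.gr i t, C.d b = 0 → (∃ a ∈ C.gr (i + 1) t, C.d a = f • b) →
    ∃ a ∈ C.gr (i + 1) (t - 1), C.d a = b

theorem ExactAt.injectiveAt {C : GradedComplex S V} {i : ℕ} {t : ℤ} (h : C.ExactAt i t) (f : S) :
    C.InjectiveAt f i t := fun b hb hd _ => h b hb hd

/-- The grading of the mapping cone of multiplication by an element of `V`. -/
def coneGr (C : GradedComplex S V) : ℕ → ℤ → AddSubgroup (C.X × C.X)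
  | 0, t => (C.gr 0 t).prod ⊥
  | i + 1, t => (C.gr (i + 1) t).prod (C.gr i t)

/-- The mapping cone of multiplication by `f`. -/
def cone (C : GradedComplex S V) (f : V) : GradedComplex S V where
  X := C.X × C.X
  d := LinearMap.prod (C.d ∘ₗ LinearMap.fst S C.X C.X + (f : S) • LinearMap.snd S C.X C.X)
    (-(C.d ∘ₗ LinearMap.snd S C.X C.X))
  gr := C.coneGr
  smul_mem := by
    rintro g hg (_ | i) t ⟨a, b⟩ ⟨ha, hb⟩
    · refine ⟨C.smul_mem g hg _ _ _ ha, ?_⟩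
      have : b = 0 := hb
      subst this
      simp
    · exact ⟨C.smul_mem g hg _ _ _ ha, C.smul_mem g hg _ _ _ hb⟩
  d_mem := by
    rintro (_ | i) t ⟨a, b⟩ ⟨ha, hb⟩
    · refine ⟨add_mem (C.d_mem _ _ _ ha) (C.smul_mem f f.2 _ _ _ hb), ?_⟩
      simpa using C.d_zero _ _ hb
    · exact ⟨add_mem (C.d_mem _ _ _ ha) (C.smul_mem f f.2 _ _ _ hb),
        (C.gr i (t + 1)).neg_mem (C.d_mem _ _ _ hb)⟩
  d_zero := by
    rintro t ⟨a, b⟩ ⟨ha, hb⟩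
    have h0 : b = 0 := hb
    have h1 : C.d a = 0 := C.d_zero _ _ ha
    simp [h0, h1]
  d_d := by
    rintro ⟨a, b⟩
    simp [C.d_d]

theorem cone_d (C : GradedComplex S V) (f : V) (a b : C.X) :
    (C.cone f).d ((a, b) : C.X × C.X) = ((C.d a + (f : S) • b, -C.d b) : C.X × C.X) := rfl

/-- The homology of the cone in degree `i + 1` maps onto the kernel of `f` on `Hᵢ(C)`: if `f • b = d
a`, then `(a, -b)` is a cycle of the cone, and a chain bounding it shows that `b` is a boundary. -/
theorem injectiveAt_of_cone {C : GradedComplex S V} {f : V} {i : ℕ} {t : ℤ}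
    (h : (C.cone f).ExactAt (i + 1) t) : C.InjectiveAt f i t := by
  rintro b hb hdb ⟨a, ha, hda⟩
  obtain ⟨⟨a', b'⟩, ⟨-, hb'⟩, hw⟩ := h ((a, -b) : C.X × C.X) ⟨ha, (C.gr i t).neg_mem hb⟩ (by
    rw [cone_d, hda, map_neg, hdb, smul_neg, add_neg_cancel, neg_zero, neg_zero]
    rfl)
  rw [cone_d] at hw
  exact ⟨b', hb', neg_injective (congrArg Prod.snd hw)⟩

/-- In the long exact sequence the homology of the cone sits between `Hᵢ₊₁(C)` and the kernel of `f`
on `Hᵢ(C)`, and both are zero here. -/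
theorem exactAt_cone {C : GradedComplex S V} {f : V} {i : ℕ} {t : ℤ}
    (h : C.ExactAt (i + 1) t) (hf : C.InjectiveAt f i t) : (C.cone f).ExactAt (i + 1) t := by
  rintro ⟨a, b⟩ ⟨ha, hb⟩ hz
  change C.X at a b
  have hz' : ((C.d a + (f : S) • b, -C.d b) : C.X × C.X) = 0 := hz
  have h1 : C.d a + (f : S) • b = 0 := congrArg Prod.fst hz'
  have h2 : C.d b = 0 := neg_eq_zero.1 (congrArg Prod.snd hz')
  obtain ⟨b', hb', rfl⟩ := hf b hb h2 ⟨-a, neg_mem ha, by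
    rw [map_neg, neg_eq_iff_add_eq_zero, h1]⟩
  obtain ⟨a', ha', h3⟩ := h (a + (f : S) • b')
    (add_mem ha (by simpa using C.smul_mem f f.2 _ _ _ hb')) (by rw [map_add, map_smul, h1])
  refine ⟨((a', -b') : C.X × C.X), ⟨ha', (C.gr (i + 1) (t - 1)).neg_mem hb'⟩, ?_⟩
  rw [cone_d, h3, smul_neg, add_neg_cancel_right, map_neg, neg_neg]

/-- A class of index `t` is sent by `f` into index `t + 1`. If the homology is zero there,
injectivity makes the class zero. So vanishing descends from large indices down to `r`. -/
theorem exactAt_of_eventually {C : GradedComplex S V} {f : V} {i : ℕ} {r : ℤ}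
    (hf : ∀ t, r ≤ t → C.InjectiveAt f i t) (h : ∃ T, ∀ t, T ≤ t → C.ExactAt i t) :
    ∀ t, r ≤ t → C.ExactAt i t := by
  obtain ⟨T, hT⟩ := h
  have key : ∀ (n : ℕ) (t : ℤ), r ≤ t → T - n ≤ t → C.ExactAt i t := by
    intro n
    induction n with
    | zero => exact fun t _ ht => hT t (by simpa using ht)
    | succ n ih =>
      intro t hrt ht z hz hdz
      refine hf t hrt z hz hdz ?_
      have := ih (t + 1) (by omega) (by push_cast at ht; omega) ((f : S) • z)
        (C.smul_mem f f.2 _ _ _ hz) (by rw [map_smul, hdz, smul_zero])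
      simpa using this
  intro t ht
  exact key (T - t).toNat t ht (by omega)

/-! ### Short exact sequences of complexes -/

/-- A short exact sequence of complexes which is also exact on the homogeneous parts. -/
structure ShortExact (A B C : GradedComplex S V) where
  f : A.X →ₗ[S] B.X
  g : B.X →ₗ[S] C.X
  f_d : ∀ x, f (A.d x) = B.d (f x)
  g_d : ∀ x, g (B.d x) = C.d (g x)
  f_injective : ∀ x, f x = 0 → x = 0
  g_f : ∀ x, g (f x) = 0
  f_mem : ∀ i t, ∀ x ∈ A.gr i t, f x ∈ B.gr i t
  g_mem : ∀ i t, ∀ x ∈ B.gr i t, g x ∈ C.gr i t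
  exists_f : ∀ i t, ∀ x ∈ B.gr i t, g x = 0 → ∃ y ∈ A.gr i t, f y = x
  exists_g : ∀ i t, ∀ x ∈ C.gr i t, ∃ y ∈ B.gr i t, g y = x

namespace ShortExact

variable {A B C : GradedComplex S V}

/-- The cones of a short exact sequence. -/
def cone (E : ShortExact A B C) (l : V) : ShortExact (A.cone l) (B.cone l) (C.cone l) where
  f := LinearMap.prodMap E.f E.f
  g := LinearMap.prodMap E.g E.g
  f_d := by
    rintro ⟨a, b⟩
    refine Prod.ext ?_ ?_
    · change E.f (A.d a + (l : S) • b) = B.d (E.f a) + (l : S) • E.f b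
      rw [map_add, E.f_d, map_smul]
    · change E.f (-A.d b) = -B.d (E.f b)
      rw [map_neg, E.f_d]
  g_d := by
    rintro ⟨a, b⟩
    refine Prod.ext ?_ ?_
    · change E.g (B.d a + (l : S) • b) = C.d (E.g a) + (l : S) • E.g b
      rw [map_add, E.g_d, map_smul]
    · change E.g (-B.d b) = -C.d (E.g b)
      rw [map_neg, E.g_d]
  f_injective := by
    rintro ⟨a, b⟩ h
    exact Prod.ext (E.f_injective _ (congrArg Prod.fst h)) (E.f_injective _ (congrArg Prod.snd h))
  g_f := by
    rintro ⟨a, b⟩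
    exact Prod.ext (E.g_f _) (E.g_f _)
  f_mem := by
    rintro (_ | i) t ⟨a, b⟩ ⟨ha, hb⟩
    · have h0 : b = 0 := hb
      subst h0
      exact ⟨E.f_mem _ _ _ ha, map_zero E.f⟩
    · exact ⟨E.f_mem _ _ _ ha, E.f_mem _ _ _ hb⟩
  g_mem := by
    rintro (_ | i) t ⟨a, b⟩ ⟨ha, hb⟩
    · have h0 : b = 0 := hb
      subst h0
      exact ⟨E.g_mem _ _ _ ha, map_zero E.g⟩
    · exact ⟨E.g_mem _ _ _ ha, E.g_mem _ _ _ hb⟩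
  exists_f := by
    rintro (_ | i) t ⟨a, b⟩ ⟨ha, hb⟩ h
    · obtain ⟨y, hy, hya⟩ := E.exists_f _ _ _ ha (congrArg Prod.fst h)
      have h0 : b = 0 := hb
      subst h0
      exact ⟨(y, 0), ⟨hy, rfl⟩, Prod.ext hya (map_zero E.f)⟩
    · obtain ⟨y, hy, hya⟩ := E.exists_f _ _ _ ha (congrArg Prod.fst h)
      obtain ⟨z, hz, hzb⟩ := E.exists_f _ _ _ hb (congrArg Prod.snd h)
      exact ⟨(y, z), ⟨hy, hz⟩, Prod.ext hya hzb⟩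
  exists_g := by
    rintro (_ | i) t ⟨a, b⟩ ⟨ha, hb⟩
    · obtain ⟨y, hy, hya⟩ := E.exists_g _ _ _ ha
      have h0 : b = 0 := hb
      subst h0
      exact ⟨(y, 0), ⟨hy, rfl⟩, Prod.ext hya (map_zero E.g)⟩
    · obtain ⟨y, hy, hya⟩ := E.exists_g _ _ _ ha
      obtain ⟨z, hz, hzb⟩ := E.exists_g _ _ _ hb
      exact ⟨(y, z), ⟨hy, hz⟩, Prod.ext hya hzb⟩

/-- The connecting map goes from `Hᵢ₊₁(C)` at index `t` to `Hᵢ(A)` at index `t + 1`: the internal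
degree `t + i + 1` is preserved while the homological degree drops. -/
theorem exactAt_right (E : ShortExact A B C) {i : ℕ} {t : ℤ} (hB : B.ExactAt (i + 1) t)
    (hA : A.ExactAt i (t + 1)) : C.ExactAt (i + 1) t := by
  intro z hz hdz
  obtain ⟨y, hy, rfl⟩ := E.exists_g _ _ _ hz
  obtain ⟨x, hx, hxy⟩ := E.exists_f _ _ _ (B.d_mem _ _ _ hy) (by rw [E.g_d, hdz])
  obtain ⟨w, hw, rfl⟩ := hA x hx (E.f_injective _ (by rw [E.f_d, hxy, B.d_d]))
  rw [add_sub_cancel_right] at hw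
  obtain ⟨v, hv, hvy⟩ := hB (y - E.f w) (sub_mem hy (E.f_mem _ _ _ hw)) (by
    rw [map_sub, ← E.f_d, hxy, sub_self])
  refine ⟨E.g v, E.g_mem _ _ _ hv, ?_⟩
  rw [← E.g_d, hvy, map_sub, E.g_f, sub_zero]

/-- If the homology of the third complex vanishes, then a cycle of the first one which bounds in the
second one bounds in the first one. -/
theorem exists_of_exactAt_right (E : ShortExact A B C) {i : ℕ} {t : ℤ} (hC : C.ExactAt (i + 1) t)
    {x : A.X} (hB : ∃ y ∈ B.gr (i + 1) t, B.d y = E.f x) : ∃ w ∈ A.gr (i + 1) t, A.d w = x := by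
  obtain ⟨y, hy, hyx⟩ := hB
  obtain ⟨c, hc, hcy⟩ := hC (E.g y) (E.g_mem _ _ _ hy) (by rw [← E.g_d, hyx, E.g_f])
  obtain ⟨b, hb, rfl⟩ := E.exists_g _ _ _ hc
  have hdb : B.d b ∈ B.gr (i + 1) t := by simpa using B.d_mem _ _ _ hb
  obtain ⟨w, hw, hwy⟩ := E.exists_f _ _ (y - B.d b) (sub_mem hy hdb) (by
    rw [map_sub, E.g_d, hcy, sub_self])
  refine ⟨w, hw, ?_⟩
  rw [← sub_eq_zero]
  refine E.f_injective _ ?_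
  rw [map_sub, E.f_d, hwy, map_sub, B.d_d, hyx, sub_zero, sub_self]

theorem exactAt_left (E : ShortExact A B C) {i : ℕ} {t : ℤ} (hC : C.ExactAt (i + 1) t)
    (hB : B.ExactAt i (t + 1)) : A.ExactAt i (t + 1) := by
  intro x hx hdx
  rw [add_sub_cancel_right]
  refine E.exists_of_exactAt_right hC ?_
  have := hB (E.f x) (E.f_mem _ _ _ hx) (by rw [← E.f_d, hdx, map_zero])
  rwa [add_sub_cancel_right] at this

theorem exactAt_zero_right (E : ShortExact A B C) {t : ℤ} (hB : B.ExactAt 0 t) :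
    C.ExactAt 0 t := by
  intro z hz _
  obtain ⟨y, hy, rfl⟩ := E.exists_g _ _ _ hz
  obtain ⟨w, hw, rfl⟩ := hB y hy (B.d_zero _ _ hy)
  exact ⟨E.g w, E.g_mem _ _ _ hw, (E.g_d w).symm⟩

end ShortExact

/-- A graded module as a complex concentrated in degree `0`. -/
def single (M : GradedMod S V) : GradedComplex S V where
  X := M.X
  d := 0
  gr i t := match i with
    | 0 => M.piece t
    | _ + 1 => ⊥
  smul_mem := by
    rintro f hf (_ | i) t x hx
    · exact M.smul_mem f hf t x hx
    · have h0 : x = 0 := hx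
      subst h0
      simp
  d_mem := fun _ _ _ _ => zero_mem _
  d_zero := fun _ _ _ => rfl
  d_d := fun _ => rfl

end GradedComplex

/-! ### Koszul complexes with coefficients in a graded module -/

namespace GradedMod

/-- The Koszul complex of a list of elements of `V` with coefficients in `M`. -/
def koszul (M : GradedMod S V) : List V → GradedComplex S V
  | [] => GradedComplex.single M
  | f :: L => (M.koszul L).cone f

theorem koszul_eq_zero_of_length_lt (M : GradedMod S V) (L : List V) :
    ∀ i t, L.length < i → ∀ x ∈ (M.koszul L).gr i t, x = 0 := by
  induction L with
  | nil =>
    rintro (_ | i) t h x hx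
    · simp at h
    · exact hx
  | cons f L ih =>
    rintro (_ | i) t h ⟨a, b⟩ hx
    · simp at h
    · rw [List.length_cons] at h
      exact Prod.ext (ih _ _ (by omega) a hx.1) (ih _ _ (by omega) b hx.2)

theorem exactAt_koszul_of_length_lt (M : GradedMod S V) (L : List V) {i : ℕ} (t : ℤ)
    (hi : L.length < i) : (M.koszul L).ExactAt i t := fun z hz _ =>
  ⟨0, zero_mem _, by rw [map_zero, M.koszul_eq_zero_of_length_lt L i t hi z hz]⟩

/-- The inclusion of `M` as the part of degree `0` of its Koszul complex. -/
def toKoszul (M : GradedMod S V) : (L : List V) → M.X →+ (M.koszul L).X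
  | [] => AddMonoidHom.id M.X
  | _ :: L => (AddMonoidHom.inl (M.koszul L).X (M.koszul L).X).comp (M.toKoszul L)

/-- The element `m` is a combination of the elements of the list, with coefficients of degree `t`. -/
def IsCombination (M : GradedMod S V) : List V → ℤ → M.X → Prop
  | [], _, m => m = 0
  | f :: L, t, m => ∃ x ∈ M.piece t, M.IsCombination L t (m - (f : S) • x)

theorem toKoszul_smul (M : GradedMod S V) (L : List V) (s : S) (m : M.X) :
    M.toKoszul L (s • m) = s • M.toKoszul L m := by
  induction L with
  | nil => rfl
  | cons f L ih => exact Prod.ext ih (smul_zero s).symm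

theorem mem_koszul_zero (M : GradedMod S V) (L : List V) (t : ℤ) (x : (M.koszul L).X) :
    x ∈ (M.koszul L).gr 0 t ↔ ∃ m ∈ M.piece t, M.toKoszul L m = x := by
  induction L with
  | nil => exact ⟨fun h => ⟨x, h, rfl⟩, by rintro ⟨m, hm, rfl⟩; exact hm⟩
  | cons f L ih =>
    obtain ⟨a, b⟩ := x
    constructor
    · rintro ⟨ha, hb⟩
      obtain ⟨m, hm, hma⟩ := (ih a).1 ha
      exact ⟨m, hm, Prod.ext hma (show (0 : (M.koszul L).X) = b from hb.symm)⟩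
    · rintro ⟨m, hm, h⟩
      exact ⟨(ih a).2 ⟨m, hm, congrArg Prod.fst h⟩, (congrArg Prod.snd h).symm⟩

/-- The boundaries of homological degree `0` are the combinations of the listed elements with
coefficients in a fixed piece. This turns statements about `H₀` into statements about membership in
ideals. -/
theorem exists_d_eq_toKoszul (M : GradedMod S V) (L : List V) (t : ℤ) (m : M.X) :
    (∃ a ∈ (M.koszul L).gr 1 t, (M.koszul L).d a = M.toKoszul L m) ↔ M.IsCombination L t m := by
  induction L generalizing m with
  | nil => exact ⟨by rintro ⟨a, -, ha⟩; exact ha.symm, fun h => ⟨0, zero_mem _, h.symm⟩⟩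
  | cons f L ih =>
    constructor
    · rintro ⟨⟨a, b⟩, ⟨ha, hb⟩, h⟩
      obtain ⟨x, hx, rfl⟩ := (M.mem_koszul_zero L t b).1 hb
      refine ⟨x, hx, (ih _).1 ⟨a, ha, ?_⟩⟩
      have h1 : (M.koszul L).d a + (f : S) • M.toKoszul L x = M.toKoszul L m :=
        congrArg Prod.fst h
      rw [map_sub, toKoszul_smul, ← h1, add_sub_cancel_right]
    · rintro ⟨x, hx, h⟩
      obtain ⟨a, ha, h1⟩ := (ih _).2 h
      have hx' := (M.mem_koszul_zero L t _).2 ⟨x, hx, rfl⟩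
      refine ⟨((a, M.toKoszul L x) : (M.koszul L).X × (M.koszul L).X), ⟨ha, hx'⟩, ?_⟩
      refine Prod.ext ?_ ?_
      · change (M.koszul L).d a + (f : S) • M.toKoszul L x = M.toKoszul L m
        rw [h1, map_sub, toKoszul_smul, sub_add_cancel]
      · change -(M.koszul L).d (M.toKoszul L x) = 0
        rw [(M.koszul L).d_zero t _ hx', neg_zero]

theorem exactAt_koszul_zero_iff (M : GradedMod S V) (L : List V) (t : ℤ) :
    (M.koszul L).ExactAt 0 t ↔ ∀ m ∈ M.piece t, M.IsCombination L (t - 1) m := by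
  constructor
  · intro h m hm
    have hm' := (M.mem_koszul_zero L t _).2 ⟨m, hm, rfl⟩
    exact (M.exists_d_eq_toKoszul L _ m).1 (h _ hm' ((M.koszul L).d_zero t _ hm'))
  · intro h z hz _
    obtain ⟨m, hm, rfl⟩ := (M.mem_koszul_zero L t _).1 hz
    exact (M.exists_d_eq_toKoszul L _ m).2 (h m hm)

theorem injectiveAt_koszul_zero_iff (M : GradedMod S V) (L : List V) (f : S) (t : ℤ) :
    (M.koszul L).InjectiveAt f 0 t ↔
      ∀ m ∈ M.piece t, M.IsCombination L t (f • m) → M.IsCombination L (t - 1) m := by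
  constructor
  · intro h m hm hc
    have hm' := (M.mem_koszul_zero L t _).2 ⟨m, hm, rfl⟩
    refine (M.exists_d_eq_toKoszul L _ m).1 (h _ hm' ((M.koszul L).d_zero t _ hm') ?_)
    rw [← toKoszul_smul]
    exact (M.exists_d_eq_toKoszul L _ _).2 hc
  · intro h z hz _ hf
    obtain ⟨m, hm, rfl⟩ := (M.mem_koszul_zero L t _).1 hz
    rw [← toKoszul_smul] at hf
    exact (M.exists_d_eq_toKoszul L _ m).2 (h m hm ((M.exists_d_eq_toKoszul L _ _).1 hf))

/-- A short exact sequence of graded modules. -/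
structure ShortExact (A B C : GradedMod S V) where
  f : A.X →ₗ[S] B.X
  g : B.X →ₗ[S] C.X
  f_injective : ∀ x, f x = 0 → x = 0
  g_f : ∀ x, g (f x) = 0
  f_mem : ∀ t, ∀ x ∈ A.piece t, f x ∈ B.piece t
  g_mem : ∀ t, ∀ x ∈ B.piece t, g x ∈ C.piece t
  exists_f : ∀ t, ∀ x ∈ B.piece t, g x = 0 → ∃ y ∈ A.piece t, f y = x
  exists_g : ∀ t, ∀ x ∈ C.piece t, ∃ y ∈ B.piece t, g y = x

/-- The short exact sequence of Koszul complexes. -/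
def ShortExact.koszul {A B C : GradedMod S V} (E : ShortExact A B C) :
    (L : List V) → GradedComplex.ShortExact (A.koszul L) (B.koszul L) (C.koszul L)
  | [] =>
    { f := E.f
      g := E.g
      f_d := fun _ => map_zero E.f
      g_d := fun _ => map_zero E.g
      f_injective := E.f_injective
      g_f := E.g_f
      f_mem := by
        rintro (_ | i) t x hx
        · exact E.f_mem t x hx
        · have h0 : x = 0 := hx
          subst h0
          exact map_zero E.f
      g_mem := by
        rintro (_ | i) t x hx
        · exact E.g_mem t x hx
        · have h0 : x = 0 := hx
          subst h0
          exact map_zero E.g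
      exists_f := by
        rintro (_ | i) t x hx h
        · exact E.exists_f t x hx h
        · have h0 : x = 0 := hx
          exact ⟨0, zero_mem _, (map_zero E.f).trans h0.symm⟩
      exists_g := by
        rintro (_ | i) t x hx
        · exact E.exists_g t x hx
        · have h0 : x = 0 := hx
          exact ⟨0, zero_mem _, (map_zero E.g).trans h0.symm⟩ }
  | f :: L => (E.koszul L).cone f

theorem ShortExact.koszul_f_toKoszul {A B C : GradedMod S V} (E : ShortExact A B C) (L : List V)
    (m : A.X) : (E.koszul L).f (A.toKoszul L m) = B.toKoszul L (E.f m) := by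
  induction L with
  | nil => rfl
  | cons f L ih => exact Prod.ext ih (map_zero (E.koszul L).f)

/-- If `H₁` of `C` vanishes, a homogeneous element of `A` which is a combination in `B` is a
combination in `A`. -/
theorem ShortExact.isCombination_of_exactAt {A B C : GradedMod S V} (E : ShortExact A B C)
    {L : List V} {t : ℤ} (hC : (C.koszul L).ExactAt 1 t) {m : A.X}
    (hm : B.IsCombination L t (E.f m)) : A.IsCombination L t m := by
  rw [← exists_d_eq_toKoszul] at hm ⊢
  rw [← E.koszul_f_toKoszul] at hm
  exact (E.koszul L).exists_of_exactAt_right hC hm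

theorem IsCombination.mem {M : GradedMod S V} {L : List V} {t : ℤ} {m : M.X}
    (h : M.IsCombination L t m) :
    m ∈ Ideal.ofList (L.map Subtype.val) • (⊤ : Submodule S M.X) := by
  induction L generalizing m with
  | nil =>
    have h0 : m = 0 := h
    rw [h0]
    exact zero_mem _
  | cons f L ih =>
    obtain ⟨x, -, hx⟩ := h
    rw [List.map_cons, Ideal.ofList_cons_smul, ← sub_add_cancel m ((f : S) • x), add_comm]
    exact Submodule.add_mem_sup (Submodule.smul_mem_pointwise_smul _ _ _ trivial) (ih hx)

/-- Compatible projections onto the homogeneous parts. -/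
structure Projection (M : GradedMod S V) where
  π : ℤ → M.X →+ M.X
  mem : ∀ t x, π t x ∈ M.piece t
  eq_self : ∀ t, ∀ x ∈ M.piece t, π t x = x
  smul : ∀ f ∈ V, ∀ t x, π (t + 1) (f • x) = f • π t x

/-- Projecting the coefficients of an arbitrary combination makes them homogeneous. Graded
combinations can therefore be exchanged for membership in `J • ⊤`. -/
theorem Projection.isCombination {M : GradedMod S V} (P : M.Projection) {L : List V} (t : ℤ)
    {m : M.X} (h : m ∈ Ideal.ofList (L.map Subtype.val) • (⊤ : Submodule S M.X)) :
    M.IsCombination L t (P.π (t + 1) m) := by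
  induction L generalizing m with
  | nil =>
    have h0 : m = 0 := by simpa using h
    rw [h0, map_zero]
    rfl
  | cons f L ih =>
    rw [List.map_cons, Ideal.ofList_cons_smul, Submodule.mem_sup] at h
    obtain ⟨y, hy, z, hz, rfl⟩ := h
    obtain ⟨x, -, rfl⟩ := Submodule.mem_smul_pointwise_iff_exists _ _ _ |>.1 hy
    refine ⟨P.π t x, P.mem t x, ?_⟩
    rw [map_add, P.smul f f.2, add_sub_cancel_left]
    exact ih hz

theorem Projection.isCombination_iff {M : GradedMod S V} (P : M.Projection) {L : List V} {t : ℤ}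
    {m : M.X} (hm : m ∈ M.piece (t + 1)) :
    M.IsCombination L t m ↔ m ∈ Ideal.ofList (L.map Subtype.val) • (⊤ : Submodule S M.X) :=
  ⟨IsCombination.mem, fun h => P.eq_self _ _ hm ▸ P.isCombination t h⟩

theorem IsCombination.map {M N : GradedMod S V} (φ : M.X →ₗ[S] N.X)
    (hφ : ∀ t, ∀ x ∈ M.piece t, φ x ∈ N.piece t) {L : List V} {t : ℤ} {m : M.X}
    (h : M.IsCombination L t m) : N.IsCombination L t (φ m) := by
  induction L generalizing m with
  | nil =>
    have h0 : m = 0 := h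
    rw [h0, map_zero]
    rfl
  | cons f L ih =>
    obtain ⟨x, hx, h1⟩ := h
    refine ⟨φ x, hφ t x hx, ?_⟩
    rw [← map_smul, ← map_sub]
    exact ih h1

end GradedMod

end Koszul

/-! ### Graded modules over polynomial rings -/

section PolynomialModules

universe u

variable {K : Type u} [Field K] {l : ℕ}

/-- The set of linear forms. -/
def linearForms (K : Type u) [Field K] (l : ℕ) : Set (MvPolynomial (Fin l) K) :=
  {f | f.IsHomogeneous 1}

/-- The homogeneous component of a polynomial, for integral degrees. -/
noncomputable def intComponent (t : ℤ) :
    MvPolynomial (Fin l) K →ₗ[K] MvPolynomial (Fin l) K :=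
  if 0 ≤ t then homogeneousComponent t.toNat else 0

theorem coeff_intComponent (t : ℤ) (p : MvPolynomial (Fin l) K) (u : Fin l →₀ ℕ) :
    coeff u (intComponent t p) = if (u.degree : ℤ) = t then coeff u p else 0 := by
  unfold intComponent
  by_cases h : 0 ≤ t
  · simp only [h, if_true, coeff_homogeneousComponent]
    congr 1
    exact propext ⟨fun h1 => by omega, fun h1 => by omega⟩
  · rw [if_neg h, if_neg (by omega)]
    simp

theorem intComponent_natCast (d : ℕ) (p : MvPolynomial (Fin l) K) :
    intComponent (d : ℤ) p = homogeneousComponent d p := by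
  simp [intComponent]

theorem intComponent_mem {I : Ideal (MvPolynomial (Fin l) K)}
    (hI : I.IsHomogeneous (homogeneousSubmodule (Fin l) K)) {p : MvPolynomial (Fin l) K}
    (hp : p ∈ I) (t : ℤ) : intComponent t p ∈ I := by
  unfold intComponent
  split_ifs
  · exact homogeneousComponent_mem_of_mem hI hp _
  · exact zero_mem _

/-- The homogeneous polynomials of degree `t`. -/
def intPiece (K : Type u) [Field K] (l : ℕ) (t : ℤ) : AddSubgroup (MvPolynomial (Fin l) K) where
  carrier := {p | ∀ u, coeff u p ≠ 0 → (u.degree : ℤ) = t}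
  zero_mem' := fun u hu => absurd (coeff_zero u) hu
  add_mem' := by
    intro p q hp hq u hu
    by_contra h
    have h1 : coeff u p = 0 := by by_contra h2; exact h (hp u h2)
    have h3 : coeff u q = 0 := by by_contra h2; exact h (hq u h2)
    exact hu (by rw [coeff_add, h1, h3, add_zero])
  neg_mem' := by
    intro p hp u hu
    exact hp u (by simpa using hu)

theorem intComponent_mem_intPiece (t : ℤ) (p : MvPolynomial (Fin l) K) :
    intComponent t p ∈ intPiece K l t := by
  intro u hu
  rw [coeff_intComponent] at hu
  by_contra h
  simp [h] at hu

theorem intComponent_of_mem {t : ℤ} {p : MvPolynomial (Fin l) K} (hp : p ∈ intPiece K l t) :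
    intComponent t p = p := by
  ext u
  rw [coeff_intComponent]
  split_ifs with h
  · rfl
  · by_contra h1
    exact h (hp u (Ne.symm h1))

theorem mem_intPiece_natCast {d : ℕ} {p : MvPolynomial (Fin l) K} :
    p ∈ intPiece K l d ↔ p.IsHomogeneous d := by
  constructor
  · intro h
    rw [← intComponent_of_mem h, intComponent_natCast]
    exact homogeneousComponent_isHomogeneous _ _
  · intro h u hu
    by_contra h1
    exact hu (h.coeff_eq_zero (by exact_mod_cast h1))

theorem intComponent_mul {f : MvPolynomial (Fin l) K} {d : ℤ} (hf : f ∈ intPiece K l d) (t : ℤ)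
    (p : MvPolynomial (Fin l) K) : intComponent (t + d) (f * p) = f * intComponent t p := by
  classical
  ext u
  rw [coeff_intComponent, coeff_mul, coeff_mul,
    show ∀ (c : Prop) [Decidable c] (F : (Fin l →₀ ℕ) × (Fin l →₀ ℕ) → K), (if c then
      ∑ x ∈ Finset.HasAntidiagonal.antidiagonal u, F x else 0) =
        ∑ x ∈ Finset.HasAntidiagonal.antidiagonal u, if c then F x else 0
      from fun c _ F => by split_ifs <;> simp]
  refine Finset.sum_congr rfl fun x hx => ?_
  rw [coeff_intComponent]
  by_cases h : coeff x.1 f = 0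
  · simp [h]
  · have h1 : (x.1.degree : ℤ) = d := hf _ h
    have h2 : u.degree = x.1.degree + x.2.degree := by
      rw [← Finset.HasAntidiagonal.mem_antidiagonal.1 hx, map_add]
    have h3 : ((u.degree : ℤ) = t + d) ↔ ((x.2.degree : ℤ) = t) := by omega
    simp only [h3, mul_ite, mul_zero]

theorem mul_mem_intPiece {f p : MvPolynomial (Fin l) K} {d : ℤ} (hf : f ∈ intPiece K l d) {t : ℤ}
    (hp : p ∈ intPiece K l t) : f * p ∈ intPiece K l (t + d) := by
  rw [← intComponent_of_mem hp, ← intComponent_mul hf]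
  exact intComponent_mem_intPiece _ _

theorem mem_intPiece_one {f : MvPolynomial (Fin l) K} (hf : f ∈ linearForms K l) :
    f ∈ intPiece K l 1 := mem_intPiece_natCast.2 hf

/-- The polynomial ring as a graded module over itself. -/
noncomputable def polyGradedMod (K : Type u) [Field K] (l : ℕ) :
    GradedMod (MvPolynomial (Fin l) K) (linearForms K l) where
  X := MvPolynomial (Fin l) K
  piece := intPiece K l
  smul_mem := fun _ hf _ _ hx => mul_mem_intPiece (mem_intPiece_one hf) hx

/-- The projections of the polynomial ring to its homogeneous parts. -/
noncomputable def polyProjection (K : Type u) [Field K] (l : ℕ) : (polyGradedMod K l).Projection where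
  π t := (intComponent t).toAddMonoidHom
  mem := intComponent_mem_intPiece
  eq_self := fun _ _ hx => intComponent_of_mem hx
  smul := fun _ hf t x => intComponent_mul (mem_intPiece_one hf) t x

/-- The graded free module `⨁ₐ S(-e a)`. -/
noncomputable def freeGradedMod (K : Type u) [Field K] (l : ℕ) {n : ℕ} (e : Fin n → ℕ) :
    GradedMod (MvPolynomial (Fin l) K) (linearForms K l) where
  X := Fin n → MvPolynomial (Fin l) K
  piece t := AddSubgroup.pi Set.univ fun a => intPiece K l (t - e a)
  smul_mem := by
    intro f hf t x hx a ha
    have := mul_mem_intPiece (mem_intPiece_one hf) (hx a ha)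
    rwa [sub_add_eq_add_sub] at this

theorem mem_piece_freeGradedMod {n : ℕ} {e : Fin n → ℕ} {t : ℤ}
    {v : Fin n → MvPolynomial (Fin l) K} :
    v ∈ (freeGradedMod K l e).piece t ↔ ∀ a, v a ∈ intPiece K l (t - e a) :=
  ⟨fun h a => h a trivial, fun h a _ => h a⟩

/-- The homogeneous component of a vector, for integral degrees. -/
noncomputable def intVectorComponent {n : ℕ} (e : Fin n → ℕ) (t : ℤ) :
    (Fin n → MvPolynomial (Fin l) K) →ₗ[K] (Fin n → MvPolynomial (Fin l) K) :=
  LinearMap.pi fun a => intComponent (t - e a) ∘ₗ LinearMap.proj a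

/-- The projections of a graded free module to its homogeneous parts. -/
noncomputable def freeProjection {n : ℕ} (e : Fin n → ℕ) :
    (freeGradedMod K l e).Projection where
  π t := (intVectorComponent e t).toAddMonoidHom
  mem := fun t x => mem_piece_freeGradedMod.2 fun a => intComponent_mem_intPiece _ _
  eq_self := fun t x hx => funext fun a =>
    intComponent_of_mem (mem_piece_freeGradedMod.1 hx a)
  smul := by
    intro f hf t x
    funext a
    change intComponent (t + 1 - e a) (f * x a) = f * intComponent (t - e a) (x a)
    rw [← intComponent_mul (mem_intPiece_one hf), sub_add_eq_add_sub]

theorem isHomogeneousVector_iff {n : ℕ} {e : Fin n → ℕ} {t : ℕ}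
    {v : Fin n → MvPolynomial (Fin l) K} :
    IsHomogeneousVector e t v ↔ v ∈ (freeGradedMod K l e).piece t := by
  rw [mem_piece_freeGradedMod]
  constructor
  · intro h a u hu
    have := h a u hu
    omega
  · intro h a u hu
    have := h a u hu
    omega

theorem mem_smul_top_pi {R : Type*} [CommRing R] {n : ℕ} {J : Ideal R} {v : Fin n → R} :
    v ∈ J • (⊤ : Submodule R (Fin n → R)) ↔ ∀ a, v a ∈ J := by
  classical
  constructor
  · intro h a
    refine Submodule.smul_induction_on h ?_ ?_
    · intro r hr x _
      exact J.mul_mem_right _ hr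
    · intro x y hx hy
      exact J.add_mem hx hy
  · intro h
    rw [← Finset.univ_sum_single v]
    refine Submodule.sum_mem _ fun a _ => ?_
    have : (Pi.single a (v a) : Fin n → R) = v a • Pi.single a 1 := by
      rw [← Pi.single_smul, smul_eq_mul, mul_one]
    rw [this]
    exact Submodule.smul_mem_smul (h a) trivial

/-! ### Regular sequences and systems of linear coordinates -/

/-- The list `[ℓ (p - 1), …, ℓ 0]`. -/
def seqList {α : Type*} (s : ℕ → α) : ℕ → List α
  | 0 => []
  | p + 1 => s p :: seqList s p

theorem length_seqList {α : Type*} (s : ℕ → α) (p : ℕ) : (seqList s p).length = p := by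
  induction p with
  | zero => rfl
  | succ p ih => simp [seqList, ih]

theorem mem_seqList {α : Type*} (s : ℕ → α) (p : ℕ) (x : α) :
    x ∈ seqList s p ↔ ∃ j < p, s j = x := by
  induction p with
  | zero => simp [seqList]
  | succ p ih =>
    rw [seqList, List.mem_cons, ih]
    constructor
    · rintro (rfl | ⟨j, hj, rfl⟩)
      · exact ⟨p, by omega, rfl⟩
      · exact ⟨j, by omega, rfl⟩
    · rintro ⟨j, hj, rfl⟩
      rcases Nat.lt_succ_iff_lt_or_eq.1 hj with h | rfl
      · exact Or.inr ⟨j, h, rfl⟩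
      · exact Or.inl rfl

theorem ofList_seqList {S : Type*} [CommRing S] {V : Set S} (s : ℕ → V) (p : ℕ) :
    Ideal.ofList ((seqList s p).map Subtype.val) =
      Ideal.span ((fun j => (s j : S)) '' Set.Iio p) := by
  unfold Ideal.ofList
  congr 1
  ext x
  simp only [List.mem_map, mem_seqList, Set.mem_ofPred_eq, Set.mem_image, Set.mem_Iio]
  constructor
  · rintro ⟨_, ⟨j, hj, rfl⟩, rfl⟩
    exact ⟨j, hj, rfl⟩
  · rintro ⟨j, hj, rfl⟩
    exact ⟨_, ⟨j, hj, rfl⟩, rfl⟩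

/-- A regular sequence has vanishing higher Koszul homology. -/
theorem exactAt_koszul_of_regular {S : Type u} [CommRing S] {V : Set S} (M : GradedMod S V)
    (P : M.Projection) (s : ℕ → V) (n : ℕ)
    (h : ∀ p < n, ∀ m : M.X,
      (s p : S) • m ∈ Ideal.span ((fun j => (s j : S)) '' Set.Iio p) • (⊤ : Submodule S M.X) →
        m ∈ Ideal.span ((fun j => (s j : S)) '' Set.Iio p) • (⊤ : Submodule S M.X))
    (i : ℕ) (t : ℤ) : (M.koszul (seqList s n)).ExactAt (i + 1) t := by
  induction n generalizing i t with
  | zero => exact M.exactAt_koszul_of_length_lt _ _ (Nat.succ_pos _)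
  | succ n ih =>
    have ih' := ih fun p hp => h p (by omega)
    -- Only `i = 0` uses the regularity of the new element, acting on `H₀`, the quotient of `M` by
    -- the earlier ones. For larger `i` the homology it acts on is already zero.
    refine GradedComplex.exactAt_cone (ih' i t) ?_
    cases i with
    | zero =>
      rw [M.injectiveAt_koszul_zero_iff]
      intro m hm hc
      rw [P.isCombination_iff (by simpa using hm), ofList_seqList]
      refine h n (by omega) m ?_
      rw [← ofList_seqList]
      exact hc.mem
    | succ i => exact (ih' i t).injectiveAt _

theorem linearIndependent_of_notMem_span {E : Type*} [AddCommGroup E] [Module K E] (s : ℕ → E)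
    (n : ℕ) (h : ∀ p < n, s p ∉ Submodule.span K (s '' Set.Iio p)) :
    LinearIndependent K fun i : Fin n => s i := by
  induction n with
  | zero => exact linearIndependent_empty_type
  | succ n ih =>
    rw [linearIndependent_finSucc']
    refine ⟨ih fun p hp => h p (by omega), fun hc => h n (by omega) ?_⟩
    refine Submodule.span_mono ?_ hc
    rintro _ ⟨i, rfl⟩
    exact ⟨i, i.2, rfl⟩

theorem finrank_linearForms :
    Module.finrank K (homogeneousSubmodule (Fin l) K 1) = l := by
  have h : LinearIndependent K (X : Fin l → MvPolynomial (Fin l) K) :=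
    MvPolynomial.linearIndependent_X (Fin l) K
  rw [homogeneousSubmodule_one_eq_span_X, finrank_span_eq_card h, Fintype.card_fin]

theorem span_eq_linearForms (s : ℕ → MvPolynomial (Fin l) K) (hs : ∀ p, (s p).IsHomogeneous 1)
    (h : ∀ p < l, s p ∉ Submodule.span K (s '' Set.Iio p)) :
    Submodule.span K (Set.range fun i : Fin l => s i) = homogeneousSubmodule (Fin l) K 1 := by
  have : FiniteDimensional K (homogeneousSubmodule (Fin l) K 1) := by
    rw [homogeneousSubmodule_one_eq_span_X]
    exact FiniteDimensional.span_of_finite K (Set.finite_range _)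
  refine Submodule.eq_of_le_of_finrank_le ?_ ?_
  · rw [Submodule.span_le]
    rintro _ ⟨i, rfl⟩
    exact hs i
  · rw [finrank_linearForms, finrank_span_eq_card (linearIndependent_of_notMem_span s l h),
      Fintype.card_fin]

/-- The kernels of the powers of `f` stabilize at some `n`. If `f x = 0` and `x = fⁿ y`, then `y` is
in the kernel of `fⁿ⁺¹`, hence of `fⁿ`, and `x = 0`. -/
theorem injective_of_surjective_ringHom {R : Type*} [CommRing R] [IsNoetherianRing R]
    (f : R →+* R) (hf : Function.Surjective f) : Function.Injective f := by
  obtain ⟨n, hn⟩ := monotone_stabilizes_iff_noetherian.2 (inferInstanceAs (IsNoetherian R R))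
    ⟨fun n => RingHom.ker (f ^ n), monotone_nat_of_le_succ fun n x hx => by
      have h1 : (f ^ n) x = 0 := hx
      change (f ^ (n + 1)) x = 0
      rw [pow_succ', RingHom.mul_def, RingHom.comp_apply, h1, map_zero]⟩
  rw [injective_iff_map_eq_zero]
  intro x hx
  have hfn : Function.Surjective (f ^ n) := by
    rw [RingHom.coe_pow]
    exact hf.iterate n
  obtain ⟨y, rfl⟩ := hfn x
  have h1 : y ∈ RingHom.ker (f ^ (n + 1)) := by
    change (f ^ (n + 1)) y = 0
    rwa [pow_succ', RingHom.mul_def, RingHom.comp_apply]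
  have h2 : RingHom.ker (f ^ n) = RingHom.ker (f ^ (n + 1)) := hn (n + 1) (Nat.le_succ n)
  rw [← h2] at h1
  exact h1

/-- The forms span all linear forms, so the endomorphism is surjective, hence injective since the
ring is Noetherian. This change of coordinates reduces regularity of the forms to that of the
variables. -/
theorem aeval_bijective (s : ℕ → MvPolynomial (Fin l) K) (hs : ∀ p, (s p).IsHomogeneous 1)
    (h : ∀ p < l, s p ∉ Submodule.span K (s '' Set.Iio p)) :
    Function.Bijective (aeval (R := K) fun i : Fin l => s i) := by
  have hsurj : Function.Surjective (aeval (R := K) fun i : Fin l => s i) := by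
    rw [← AlgHom.range_eq_top, ← top_le_iff, ← adjoin_range_X, Algebra.adjoin_le_iff]
    rintro _ ⟨i, rfl⟩
    have h1 : (X i : MvPolynomial (Fin l) K) ∈
        Submodule.span K (Set.range fun i : Fin l => s i) := by
      rw [span_eq_linearForms s hs h]
      exact isHomogeneous_X K i
    refine Submodule.span_le (p := (aeval (R := K) fun i : Fin l => s i).range.toSubmodule).2 ?_ h1
    rintro _ ⟨j, rfl⟩
    exact ⟨X j, aeval_X _ j⟩
  exact ⟨injective_of_surjective_ringHom
    (aeval (R := K) fun i : Fin l => s i).toRingHom hsurj, hsurj⟩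

/-- Membership in an ideal generated by variables is tested on monomials, and multiplying by `X p`
does not alter the exponents of the variables in `T`. -/
theorem mem_span_X_of_mul_mem {p : Fin l} {g : MvPolynomial (Fin l) K} {T : Set (Fin l)}
    (hp : p ∉ T) (h : X p * g ∈ Ideal.span (X '' T : Set (MvPolynomial (Fin l) K))) :
    g ∈ Ideal.span (X '' T : Set (MvPolynomial (Fin l) K)) := by
  classical
  rw [mem_ideal_span_X_image] at h ⊢
  intro m hm
  obtain ⟨i, hi, hi'⟩ := h (Finsupp.single p 1 + m) (by
    rw [mem_support_iff, coeff_X_mul]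
    exact mem_support_iff.1 hm)
  refine ⟨i, hi, ?_⟩
  rwa [Finsupp.add_apply, Finsupp.single_eq_of_ne (by rintro rfl; exact hp hi), zero_add] at hi'

/-- Linearly independent linear forms are a regular sequence. -/
theorem mem_span_of_mul_mem (s : ℕ → MvPolynomial (Fin l) K) (hs : ∀ p, (s p).IsHomogeneous 1)
    (h : ∀ p < l, s p ∉ Submodule.span K (s '' Set.Iio p)) {p : ℕ} (hp : p < l)
    {g : MvPolynomial (Fin l) K} (hg : s p * g ∈ Ideal.span (s '' Set.Iio p)) :
    g ∈ Ideal.span (s '' Set.Iio p) := by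
  set φ := aeval (R := K) fun i : Fin l => s i with hφ
  have hb : Function.Bijective φ := aeval_bijective s hs h
  have himg : s '' Set.Iio p = φ '' (X '' {i : Fin l | (i : ℕ) < p}) := by
    ext x
    constructor
    · rintro ⟨j, hj, rfl⟩
      exact ⟨_, ⟨⟨j, lt_trans hj hp⟩, hj, rfl⟩, by simp [hφ]⟩
    · rintro ⟨_, ⟨i, hi, rfl⟩, rfl⟩
      exact ⟨i, hi, by simp [hφ]⟩
  have hmem : ∀ y, φ y ∈ Ideal.span (s '' Set.Iio p) ↔
      y ∈ Ideal.span (X '' {i : Fin l | (i : ℕ) < p}) := by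
    intro y
    rw [himg]
    have h1 : Ideal.span (φ '' (X '' {i : Fin l | (i : ℕ) < p})) =
        Ideal.map φ (Ideal.span (X '' {i : Fin l | (i : ℕ) < p})) := (Ideal.map_span φ _).symm
    rw [h1, Ideal.mem_map_iff_of_surjective _ hb.2]
    constructor
    · rintro ⟨x, hx, hxy⟩
      rwa [← hb.1 hxy]
    · exact fun hy => ⟨y, hy, rfl⟩
  obtain ⟨y, rfl⟩ := hb.2 g
  have h2 : s p * φ y = φ (X (⟨p, hp⟩ : Fin l) * y) := by simp [hφ]
  rw [h2, hmem] at hg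
  rw [hmem]
  exact mem_span_X_of_mul_mem (by simp) hg

theorem span_seq_eq (s : ℕ → MvPolynomial (Fin l) K) (hs : ∀ p, (s p).IsHomogeneous 1)
    (h : ∀ p < l, s p ∉ Submodule.span K (s '' Set.Iio p)) :
    Ideal.span (s '' Set.Iio l) = Ideal.span (Set.range X) := by
  have himg : s '' Set.Iio l = Set.range fun i : Fin l => s i := by
    ext x
    constructor
    · rintro ⟨j, hj, rfl⟩
      exact ⟨⟨j, hj⟩, rfl⟩
    · rintro ⟨i, rfl⟩
      exact ⟨i, i.2, rfl⟩
  have h1 := span_eq_linearForms s hs h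
  rw [homogeneousSubmodule_one_eq_span_X] at h1
  have h2 := congrArg (fun N : Submodule K (MvPolynomial (Fin l) K) =>
    Ideal.span (N : Set (MvPolynomial (Fin l) K))) h1
  simp only [Submodule.span_span_of_tower, Ideal.span] at h2
  rw [himg]
  exact h2

end PolynomialModules

/-! ### Koszul homology and free resolutions -/

section Resolutions

universe u

variable {K : Type u} [Field K] {l : ℕ}

theorem mem_span_range_X {p : MvPolynomial (Fin l) K} :
    p ∈ Ideal.span (Set.range (X : Fin l → MvPolynomial (Fin l) K)) ↔ coeff 0 p = 0 := by
  rw [← Set.image_univ, mem_ideal_span_X_image]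
  constructor
  · intro h
    by_contra h0
    obtain ⟨i, -, hi⟩ := h 0 (mem_support_iff.2 h0)
    exact hi rfl
  · intro h m hm
    by_contra! h1
    have : m = 0 := Finsupp.ext fun i => h1 i trivial
    subst this
    exact mem_support_iff.1 hm h

theorem mem_smul_top_self {R : Type*} [CommRing R] {J : Ideal R} {m : R} :
    m ∈ J • (⊤ : Submodule R R) ↔ m ∈ J := by
  rw [smul_eq_mul, Ideal.mul_top]

namespace GradedMod

variable {S : Type u} [CommRing S] {V : Set S}

/-- A submodule of a graded module, with the induced grading. -/
def sub (M : GradedMod S V) (N : Submodule S M.X) : GradedMod S V where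
  X := N
  piece t := (M.piece t).comap N.subtype.toAddMonoidHom
  smul_mem := fun f hf t x hx => M.smul_mem f hf t x hx

/-- A map which commutes with the projections to the homogeneous parts gives a short exact
sequence. -/
def shortExactOfMap {F G : GradedMod S V} (P : F.Projection) (Q : G.Projection) (φ : F.X →ₗ[S] G.X)
    (hφ : ∀ t x, φ (P.π t x) = Q.π t (φ x)) {N' : Submodule S F.X} (hN' : N' = LinearMap.ker φ)
    {N : Submodule S G.X} (hN : LinearMap.range φ = N) : ShortExact (F.sub N') F (G.sub N) where
  f := N'.subtype
  g := φ.codRestrict N fun x => hN ▸ LinearMap.mem_range_self φ x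
  f_injective := fun x hx => Subtype.ext hx
  g_f := fun x => Subtype.ext (LinearMap.mem_ker.1 (hN' ▸ x.2))
  f_mem := fun t x hx => hx
  g_mem := by
    intro t x hx
    change φ x ∈ G.piece t
    rw [← P.eq_self t x hx, hφ]
    exact Q.mem t _
  exists_f := by
    intro t x hx h
    have h1 : φ x = 0 := congrArg Subtype.val h
    exact ⟨⟨x, hN' ▸ LinearMap.mem_ker.2 h1⟩, hx, rfl⟩
  exists_g := by
    rintro t ⟨y, hyN⟩ hy
    obtain ⟨x, rfl⟩ := (hN.symm ▸ hyN : y ∈ LinearMap.range φ)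
    refine ⟨P.π t x, P.mem t x, Subtype.ext ?_⟩
    change φ (P.π t x) = φ x
    rw [hφ]
    exact Q.eq_self t _ hy

end GradedMod

/-- The quotient of the polynomial ring by an ideal as a graded module. -/
noncomputable def quotGradedMod (I : Ideal (MvPolynomial (Fin l) K)) :
    GradedMod (MvPolynomial (Fin l) K) (linearForms K l) where
  X := MvPolynomial (Fin l) K ⧸ I
  piece t := (intPiece K l t).map (Submodule.mkQ I).toAddMonoidHom
  smul_mem := by
    rintro f hf t _ ⟨x, hx, rfl⟩
    exact ⟨f * x, mul_mem_intPiece (mem_intPiece_one hf) hx, rfl⟩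

/-- The short exact sequence `0 → I → S → S ⧸ I → 0`. -/
noncomputable def quotShortExact (I : Ideal (MvPolynomial (Fin l) K)) :
    GradedMod.ShortExact ((polyGradedMod K l).sub I) (polyGradedMod K l) (quotGradedMod I) where
  f := Submodule.subtype I
  g := Submodule.mkQ I
  f_injective := fun x hx => Subtype.ext hx
  g_f := fun x => (Submodule.Quotient.mk_eq_zero I).2 x.2
  f_mem := fun t x hx => hx
  g_mem := fun t x hx => ⟨x, hx, rfl⟩
  exists_f := fun t x hx h => ⟨⟨x, (Submodule.Quotient.mk_eq_zero I).1 h⟩, hx, rfl⟩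
  exists_g := by
    rintro t _ ⟨x, hx, rfl⟩
    exact ⟨x, hx, rfl⟩

/-- A map from a graded free module which is homogeneous on the basis commutes with the
projections to the homogeneous parts. -/
theorem map_intVectorComponent {m : ℕ} {e : Fin m → ℕ}
    {G : GradedMod (MvPolynomial (Fin l) K) (linearForms K l)} (Q : G.Projection)
    (φ : (Fin m → MvPolynomial (Fin l) K) →ₗ[MvPolynomial (Fin l) K] G.X)
    (hφ : ∀ b t (p : MvPolynomial (Fin l) K), Q.π t (p • φ (Pi.single b 1)) =
      intComponent (t - e b) p • φ (Pi.single b 1))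
    (t : ℤ) (v : Fin m → MvPolynomial (Fin l) K) :
    φ ((freeProjection e).π t v) = Q.π t (φ v) := by
  classical
  have hv : ∀ w : Fin m → MvPolynomial (Fin l) K, φ w = ∑ b, w b • φ (Pi.single b 1) := by
    intro w
    conv_lhs => rw [← Finset.univ_sum_single w]
    rw [map_sum]
    refine Finset.sum_congr rfl fun b _ => ?_
    rw [← map_smul, ← Pi.single_smul, smul_eq_mul, mul_one]
  refine (hv _).trans ?_
  rw [hv v, map_sum]
  exact Finset.sum_congr rfl fun b _ => (hφ b t (v b)).symm

/-! ### Dimension shifting along the minimal resolution of `S ⧸ I` -/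

namespace MinimalGradedFreeResolution

variable {I : Ideal (MvPolynomial (Fin l) K)} (F : MinimalGradedFreeResolution I)

theorem aug_component (t : ℤ) (v : Fin (F.rank 0) → MvPolynomial (Fin l) K) :
    F.aug ((freeProjection (F.deg 0)).π t v) = (polyProjection K l).π t (F.aug v) := by
  refine map_intVectorComponent (polyProjection K l) F.aug (fun b t p => ?_) t v
  have h := intComponent_mul (mem_intPiece_natCast.2 (F.aug_homogeneous b)) (t - F.deg 0 b) p
  rw [sub_add_cancel, mul_comm, mul_comm _ (intComponent _ _)] at h
  exact h

theorem d_component (i : ℕ) (t : ℤ) (v : Fin (F.rank (i + 1)) → MvPolynomial (Fin l) K) :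
    F.d i ((freeProjection (F.deg (i + 1))).π t v) =
      (freeProjection (F.deg i)).π t (F.d i v) := by
  refine map_intVectorComponent (freeProjection (F.deg i)) (F.d i) (fun b t p => ?_) t v
  funext a
  have h := intComponent_mul (mem_piece_freeGradedMod.1
    (isHomogeneousVector_iff.1 (F.d_homogeneous i b)) a) (t - F.deg (i + 1) b) p
  rw [sub_add_sub_cancel, mul_comm, mul_comm _ (intComponent _ _)] at h
  exact h

/-- The syzygy modules of `S ⧸ I`. -/
noncomputable def syzygy : ℕ → GradedMod (MvPolynomial (Fin l) K) (linearForms K l)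
  | 0 => quotGradedMod I
  | 1 => (polyGradedMod K l).sub I
  | n + 2 => (freeGradedMod K l (F.deg n)).sub (LinearMap.range (F.d n))

/-- The free modules in the resolution of `S ⧸ I`. -/
noncomputable def term : ℕ → GradedMod (MvPolynomial (Fin l) K) (linearForms K l)
  | 0 => polyGradedMod K l
  | n + 1 => freeGradedMod K l (F.deg n)

/-- The short exact sequences into which the resolution of `S ⧸ I` splits. -/
noncomputable def shortExact :
    (n : ℕ) → GradedMod.ShortExact (F.syzygy (n + 1)) (F.term n) (F.syzygy n)
  | 0 => quotShortExact I
  | 1 => GradedMod.shortExactOfMap (freeProjection (F.deg 0)) (polyProjection K l) F.aug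
      F.aug_component F.exact_zero F.range_aug
  | n + 2 => GradedMod.shortExactOfMap (freeProjection (F.deg (n + 1))) (freeProjection (F.deg n))
      (F.d n) (F.d_component n) (F.exact_succ n) rfl

variable {s : ℕ → linearForms K l}
  (hs : ∀ p < l, (s p : MvPolynomial (Fin l) K) ∉
    Submodule.span K ((fun j => (s j : MvPolynomial (Fin l) K)) '' Set.Iio p))
include hs

theorem ofList_eq : Ideal.ofList ((seqList s l).map Subtype.val) =
    Ideal.span (Set.range (X : Fin l → MvPolynomial (Fin l) K)) := by
  rw [ofList_seqList]
  exact span_seq_eq _ (fun p => (s p).2) hs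

theorem exactAt_term (n i : ℕ) (t : ℤ) :
    ((F.term n).koszul (seqList s l)).ExactAt (i + 1) t := by
  cases n with
  | zero =>
    refine exactAt_koszul_of_regular _ (polyProjection K l) s l (fun p hp m hm => ?_) i t
    exact (mem_smul_top_self (R := MvPolynomial (Fin l) K)).2
      (mem_span_of_mul_mem _ (fun p => (s p).2) hs hp ((mem_smul_top_self (R := MvPolynomial (Fin l) K)).1 hm))
  | succ n =>
    refine exactAt_koszul_of_regular _ (freeProjection (F.deg n)) s l (fun p hp m hm => ?_) i t
    have h1 := mem_smul_top_pi.1 hm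
    exact mem_smul_top_pi.2 fun a => mem_span_of_mul_mem _ (fun p => (s p).2) hs hp (h1 a)

theorem exactAt_zero_term {n : ℕ} {t : ℤ} (ht : ∀ a, (F.deg n a : ℤ) < t) :
    ((F.term (n + 1)).koszul (seqList s l)).ExactAt 0 t := by
  rw [GradedMod.exactAt_koszul_zero_iff]
  intro v hv
  refine ((freeProjection (F.deg n)).isCombination_iff (by rw [sub_add_cancel]; exact hv)).2 ?_
  rw [ofList_eq hs]
  refine mem_smul_top_pi.2 fun a => mem_span_range_X.2 ?_
  by_contra h
  have h1 := mem_piece_freeGradedMod.1 hv a 0 h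
  have h2 := ht a
  rw [map_zero] at h1
  push_cast at h1
  omega

/-- Dimension shifting along the resolution. -/
theorem exactAt_syzygy {r : ℕ} (hr : ∀ n a, F.deg n a ≤ r + n) (i n : ℕ) (hin : 1 ≤ i + n) (t : ℤ)
    (ht : (r : ℤ) + n ≤ t) : ((F.syzygy n).koszul (seqList s l)).ExactAt i t := by
  induction i generalizing n t with
  | zero =>
    obtain ⟨n, rfl⟩ : ∃ m, n = m + 1 := ⟨n - 1, by omega⟩
    -- `H₀` of the syzygy module is a quotient of `H₀` of the free module covering it. The latter
    -- vanishes beyond the degrees of the basis, which are at most `r + n`, whereas `t ≥ r + n + 1`.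
    refine ((F.shortExact (n + 1)).koszul _).exactAt_zero_right (F.exactAt_zero_term hs ?_)
    intro a
    have := hr n a
    push_cast at ht
    omega
  | succ i ih =>
    exact ((F.shortExact n).koszul _).exactAt_right (F.exactAt_term hs n i t)
      (ih (n + 1) (by omega) (t + 1) (by push_cast; omega))

/-- Shifting in the other direction identifies this homology with `H` of `S ⧸ I` in homological
degree `i + 1 + n`, which exceeds the length `l` of the Koszul complex. -/
theorem exactAt_syzygy_of_lt (n i : ℕ) (hi : l < i + 1 + n) (t : ℤ) :
    ((F.syzygy n).koszul (seqList s l)).ExactAt (i + 1) t := by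
  induction n generalizing i t with
  | zero =>
    refine GradedMod.exactAt_koszul_of_length_lt _ _ t ?_
    rw [length_seqList]
    omega
  | succ n ih =>
    have := ((F.shortExact n).koszul _).exactAt_left (ih (i + 1) (by omega) (t - 1))
      (F.exactAt_term hs n i _)
    rwa [sub_add_cancel] at this

/-- By minimality the image `N` of `d` lies in `𝔪F`. Since `H₁` of `F/N` vanishes in this range, a
homogeneous generator of `N` lying in `𝔪F` already lies in `𝔪N`. So `N = 𝔪N`, and Nakayama gives
some `r ≡ 1` modulo `𝔪` killing `N`; as `N` sits in a free module over a domain, it is zero. -/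
theorem range_d_eq_bot {n : ℕ} (hn : l ≤ n + 1) : LinearMap.range (F.d n) = ⊥ := by
  classical
  set 𝔪 := Ideal.span (Set.range (X : Fin l → MvPolynomial (Fin l) K)) with h𝔪
  set N := LinearMap.range (F.d n) with hN
  have hle : N ≤ 𝔪 • N := by
    have hgen : ∀ b, F.d n (Pi.single b 1) ∈ 𝔪 • N := by
      intro b
      have hhom := isHomogeneousVector_iff.1 (F.d_homogeneous n b)
      let y : (F.syzygy (n + 2)).X := (⟨F.d n (Pi.single b 1), LinearMap.mem_range_self _ _⟩ : N)
      have hcomb : (F.term (n + 1)).IsCombination (seqList s l) (F.deg (n + 1) b - 1)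
          ((F.shortExact (n + 1)).f y) := by
        have hy : (F.shortExact (n + 1)).f y = F.d n (Pi.single b 1) := by
          cases n <;> rfl
        rw [hy]
        refine ((freeProjection (F.deg n)).isCombination_iff (by rw [sub_add_cancel]; exact hhom)).2 ?_
        rw [ofList_eq hs]
        refine mem_smul_top_pi.2 fun a => mem_span_range_X.2 ?_
        rw [← constantCoeff_eq]
        exact F.minimal n _ a
      have h1 := ((F.shortExact (n + 1)).isCombination_of_exactAt
        (F.exactAt_syzygy_of_lt hs (n + 1) 0 (by omega) _) hcomb).mem
      rw [ofList_eq hs, ← h𝔪] at h1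
      have h2 : N.subtype (y : N) ∈ Submodule.map N.subtype (𝔪 • (⊤ : Submodule _ N)) :=
        Submodule.mem_map_of_mem h1
      rw [Submodule.map_smul'', Submodule.map_subtype_top] at h2
      exact h2
    rintro _ ⟨v, rfl⟩
    rw [← Finset.univ_sum_single v, map_sum]
    refine Submodule.sum_mem _ fun b _ => ?_
    have : (Pi.single b (v b) : Fin (F.rank (n + 1)) → MvPolynomial (Fin l) K) =
        v b • Pi.single b 1 := by
      rw [← Pi.single_smul, smul_eq_mul, mul_one]
    rw [this, map_smul]
    exact Submodule.smul_mem _ _ (hgen b)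
  obtain ⟨r, hr, hrN⟩ := Submodule.exists_sub_one_mem_and_smul_eq_zero_of_fg_of_le_smul 𝔪 N
    (IsNoetherian.noetherian N) hle
  have hr0 : r ≠ 0 := by
    rintro rfl
    rw [mem_span_range_X] at hr
    simp at hr
  rw [Submodule.eq_bot_iff]
  intro x hx
  funext a
  have h1 : r * x a = 0 := congrFun (hrN x hx) a
  exact (mul_eq_zero.1 h1).resolve_left hr0

/-- The syzygy theorem: the resolution has finite length. -/
theorem rank_eq_zero {n : ℕ} (hn : l ≤ n) : F.rank (n + 1) = 0 := by
  classical
  by_contra h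
  let b : Fin (F.rank (n + 1)) := ⟨0, Nat.pos_of_ne_zero h⟩
  -- The differential out of this module is zero, so by exactness a basis vector would be a
  -- boundary, but boundaries have no constant terms.
  have h1 : (Pi.single b 1 : Fin (F.rank (n + 1)) → MvPolynomial (Fin l) K) ∈
      LinearMap.range (F.d (n + 1)) := by
    rw [F.exact_succ n, LinearMap.mem_ker]
    have h2 := LinearMap.mem_range_self (F.d n) (Pi.single b 1)
    rw [F.range_d_eq_bot hs (by omega)] at h2
    exact h2
  obtain ⟨v, hv⟩ := h1
  have h3 := F.minimal (n + 1) v b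
  rw [hv] at h3
  simp at h3

end MinimalGradedFreeResolution

/-! ### Regularity and Koszul homology of `S ⧸ I` -/

variable {I : Ideal (MvPolynomial (Fin l) K)}
  (hI : I.IsHomogeneous (homogeneousSubmodule (Fin l) K))
  {s : ℕ → linearForms K l}
  (hs : ∀ p < l, (s p : MvPolynomial (Fin l) K) ∉
    Submodule.span K ((fun j => (s j : MvPolynomial (Fin l) K)) '' Set.Iio p))
include hs

/-- The supremum of an unbounded set of naturals is `0`, so boundedness has to be shown first. It
follows from the finite length of the resolution. Basis vectors of degree at most `n` satisfy the
bound trivially. -/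
theorem deg_le_regularity (n : ℕ)
    (a : Fin ((Classical.choice (exists_minimalGradedFreeResolution hI)).rank n)) :
    (Classical.choice (exists_minimalGradedFreeResolution hI)).deg n a ≤
      castelnuovoMumfordRegularity I hI + n := by
  classical
  revert a
  set F := Classical.choice (exists_minimalGradedFreeResolution hI) with hF
  intro a
  have hbetti : ∀ i j, gradedBetti I hI i j ≠ 0 ↔ ∃ a, F.deg i a = j := by
    intro i j
    change (Finset.univ.filter fun a => F.deg i a = j).card ≠ 0 ↔ _
    rw [Finset.card_ne_zero]
    constructor
    · rintro ⟨a, ha⟩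
      exact ⟨a, (Finset.mem_filter.1 ha).2⟩
    · rintro ⟨a, ha⟩
      exact ⟨a, Finset.mem_filter.2 ⟨Finset.mem_univ a, ha⟩⟩
  have hbdd : BddAbove {r : ℕ | ∃ i j, gradedBetti I hI i j ≠ 0 ∧ j = i + r} := by
    refine ⟨(Finset.range (l + 1)).sup fun i => Finset.univ.sup fun a => F.deg i a, ?_⟩
    rintro r ⟨i, j, hij, rfl⟩
    obtain ⟨a, ha⟩ := (hbetti _ _).1 hij
    have hi : i ∈ Finset.range (l + 1) := by
      rw [Finset.mem_range]
      by_contra h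
      obtain ⟨m, rfl⟩ : ∃ m, i = m + 1 := ⟨i - 1, by omega⟩
      have h1 := a.2
      have h2 := F.rank_eq_zero hs (by omega : l ≤ m)
      omega
    have h1 := Finset.le_sup (f := fun a => F.deg i a) (Finset.mem_univ a)
    have h2 := Finset.le_sup (f := fun i => Finset.univ.sup fun a => F.deg i a) hi
    change F.deg i a ≤ _ at h1
    omega
  by_cases h : F.deg n a ≤ n
  · omega
  · have := le_csSup hbdd (show F.deg n a - n ∈ _ from
      ⟨n, F.deg n a, (hbetti _ _).2 ⟨a, rfl⟩, by omega⟩)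
    change F.deg n a - n ≤ castelnuovoMumfordRegularity I hI at this
    omega

/-- Here the bound on the degrees in the resolution becomes vanishing of Koszul homology. Index `t ≥
reg I` means internal degree at least `reg I + i + 1`. -/
theorem exactAt_koszul_quot (i : ℕ) (t : ℤ) (ht : (castelnuovoMumfordRegularity I hI : ℤ) ≤ t) :
    ((quotGradedMod I).koszul (seqList s l)).ExactAt (i + 1) t :=
  (Classical.choice (exists_minimalGradedFreeResolution hI)).exactAt_syzygy hs
    (deg_le_regularity hI hs) (i + 1) 0 (by omega) t (by simpa using ht)

omit hs

theorem isCombination_quot_iff (hI : I.IsHomogeneous (homogeneousSubmodule (Fin l) K))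
    (s : ℕ → linearForms K l) (p : ℕ) {t : ℤ}
    {g : MvPolynomial (Fin l) K} (hg : g ∈ intPiece K l (t + 1)) :
    (quotGradedMod I).IsCombination (seqList s p) t (Submodule.mkQ I g) ↔
      g ∈ I ⊔ Ideal.span ((fun j => (s j : MvPolynomial (Fin l) K)) '' Set.Iio p) := by
  rw [← ofList_seqList]
  constructor
  · intro h
    have h1 := h.mem
    have h2 : Submodule.mkQ I g ∈ Submodule.map (Submodule.mkQ I)
        (Ideal.ofList ((seqList s p).map Subtype.val) •
          (⊤ : Submodule (MvPolynomial (Fin l) K) (MvPolynomial (Fin l) K))) := by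
      rw [Submodule.map_smul'', Submodule.map_top, Submodule.range_mkQ]
      exact h1
    obtain ⟨y, hy, hyg⟩ := h2
    rw [SetLike.mem_coe, smul_eq_mul, Ideal.mul_top] at hy
    have h3 : g - y ∈ I := (Submodule.Quotient.eq I).1 hyg.symm
    rw [← sub_add_cancel g y]
    exact Submodule.add_mem_sup h3 hy
  · intro h
    obtain ⟨x, hx, y, hy, hxy⟩ := Submodule.mem_sup.1 h
    have h1 : (polyGradedMod K l).IsCombination (seqList s p) t (intComponent (t + 1) y) :=
      (polyProjection K l).isCombination t (m := y) ((mem_smul_top_self (R := MvPolynomial (Fin l) K)).2 hy)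
    have h2 := h1.map (N := quotGradedMod I) (Submodule.mkQ I) (fun t x hx => ⟨x, hx, rfl⟩)
    have h3 : Submodule.mkQ I g = Submodule.mkQ I (intComponent (t + 1) y) := by
      refine (Submodule.Quotient.eq I).2 ?_
      rw [← intComponent_of_mem hg, ← hxy, map_add, add_sub_cancel_right]
      exact intComponent_mem hI hx _
    rw [h3]
    exact h2

theorem injectiveAt_quot_iff (hI : I.IsHomogeneous (homogeneousSubmodule (Fin l) K))
    (s : ℕ → linearForms K l) (p : ℕ) (f : linearForms K l) (t : ℤ) :
    ((quotGradedMod I).koszul (seqList s p)).InjectiveAt f 0 t ↔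
      ∀ g ∈ intPiece K l t,
        (f : MvPolynomial (Fin l) K) * g ∈
          I ⊔ Ideal.span ((fun j => (s j : MvPolynomial (Fin l) K)) '' Set.Iio p) →
        g ∈ I ⊔ Ideal.span ((fun j => (s j : MvPolynomial (Fin l) K)) '' Set.Iio p) := by
  rw [GradedMod.injectiveAt_koszul_zero_iff]
  constructor
  · intro h g hg hfg
    have h1 := h _ ⟨g, hg, rfl⟩ ((isCombination_quot_iff hI s p
      (mul_mem_intPiece (mem_intPiece_one f.2) hg)).2 hfg)
    exact (isCombination_quot_iff hI s p (by simpa using hg)).1 h1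
  · rintro h _ ⟨g, hg, rfl⟩ hfg
    have h1 := h g hg ((isCombination_quot_iff hI s p
      (mul_mem_intPiece (mem_intPiece_one f.2) hg)).1 hfg)
    exact (isCombination_quot_iff hI s p (by simpa using hg)).2 h1

/-- For a system of linear coordinates which is a filter regular sequence on `S ⧸ I`, the
multiplication maps are injective from the degree `reg I` on. -/
theorem mem_of_mul_mem_of_regularity_le
    (hs : ∀ p < l, (s p : MvPolynomial (Fin l) K) ∉
      Submodule.span K ((fun j => (s j : MvPolynomial (Fin l) K)) '' Set.Iio p))
    (hfr : ∀ p < l, ∃ T : ℕ, ∀ t, T ≤ t → ∀ g : MvPolynomial (Fin l) K, g.IsHomogeneous t →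
      (s p : MvPolynomial (Fin l) K) * g ∈
        I ⊔ Ideal.span ((fun j => (s j : MvPolynomial (Fin l) K)) '' Set.Iio p) →
      g ∈ I ⊔ Ideal.span ((fun j => (s j : MvPolynomial (Fin l) K)) '' Set.Iio p))
    {p : ℕ} (hp : p < l) {t : ℕ} (ht : castelnuovoMumfordRegularity I hI ≤ t)
    {g : MvPolynomial (Fin l) K} (hg : g.IsHomogeneous t)
    (h : (s p : MvPolynomial (Fin l) K) * g ∈
        I ⊔ Ideal.span ((fun j => (s j : MvPolynomial (Fin l) K)) '' Set.Iio p)) :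
    g ∈ I ⊔ Ideal.span ((fun j => (s j : MvPolynomial (Fin l) K)) '' Set.Iio p) := by
  set r := castelnuovoMumfordRegularity I hI with hr
  have hfr' : ∀ p < l, ∃ T : ℤ, ∀ t, T ≤ t →
      ((quotGradedMod I).koszul (seqList s p)).InjectiveAt (s p) 0 t := by
    intro p hp
    obtain ⟨T, hT⟩ := hfr p hp
    refine ⟨T, fun t ht => (injectiveAt_quot_iff hI s p (s p) t).2 ?_⟩
    lift t to ℕ using (by omega)
    exact fun g hg => hT t (by omega) g (mem_intPiece_natCast.1 hg)
  -- Upward induction on `p`: filter regularity makes the higher homology of the first `p` forms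
  -- vanish in large degrees, with no control on where this starts.
  have hev : ∀ p ≤ l, ∀ i, ∃ T : ℤ, ∀ t, T ≤ t →
      ((quotGradedMod I).koszul (seqList s p)).ExactAt (i + 1) t := by
    intro p
    induction p with
    | zero =>
      exact fun _ i => ⟨0, fun t _ => GradedMod.exactAt_koszul_of_length_lt _ _ _ (Nat.succ_pos i)⟩
    | succ p ih =>
      intro hp i
      obtain ⟨T₁, hT₁⟩ := ih (by omega) i
      obtain ⟨T₂, hT₂⟩ : ∃ T : ℤ, ∀ t, T ≤ t →
          ((quotGradedMod I).koszul (seqList s p)).InjectiveAt (s p) i t := by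
        cases i with
        | zero => exact hfr' p (by omega)
        | succ i =>
          obtain ⟨T, hT⟩ := ih (by omega) i
          exact ⟨T, fun t ht => (hT t ht).injectiveAt _⟩
      exact ⟨max T₁ T₂, fun t ht => GradedComplex.exactAt_cone
        (hT₁ t (le_trans (le_max_left _ _) ht)) (hT₂ t (le_trans (le_max_right _ _) ht))⟩
  -- Downward induction from all `l` forms, where the regularity gives the sharp bound `r`. Removing
  -- a form keeps the bound, because `hev` supplies the vanishing from which to descend.
  have hex : ∀ q ≤ l, ∀ i t, (r : ℤ) ≤ t →
      ((quotGradedMod I).koszul (seqList s (l - q))).ExactAt (i + 1) t := by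
    intro q
    induction q with
    | zero => exact fun _ i t ht => exactAt_koszul_quot hI hs i t ht
    | succ q ih =>
      intro hq i
      refine GradedComplex.exactAt_of_eventually (f := s (l - (q + 1))) (fun t ht => ?_)
        (hev _ (by omega) i)
      refine GradedComplex.injectiveAt_of_cone ?_
      have h1 := ih (by omega) (i + 1) t ht
      rw [show l - q = l - (q + 1) + 1 by omega] at h1
      exact h1
  have h1 := hex (l - (p + 1)) (by omega) 0 t (by omega)
  rw [show l - (l - (p + 1)) = p + 1 by omega] at h1
  exact (injectiveAt_quot_iff hI s p (s p) t).1 (GradedComplex.injectiveAt_of_cone h1) g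
    (mem_intPiece_natCast.2 hg) h

end Resolutions

/-! ### Generic linear forms -/

section Generic

universe u

variable {K : Type u} [Field K] {l : ℕ}

theorem intComponent_mem_pow {N : ℕ} {t : ℤ} (ht : (N : ℤ) ≤ t) (p : MvPolynomial (Fin l) K) :
    intComponent t p ∈ idealOfVars (Fin l) K ^ N := by
  rw [mem_pow_idealOfVars_iff]
  intro u hu
  have := intComponent_mem_intPiece t p u (mem_support_iff.1 hu)
  have h2 : (N : ℤ) ≤ u.degree := by omega
  exact_mod_cast h2

theorem sum_intComponent {p : MvPolynomial (Fin l) K} {D : ℕ} (hD : p.totalDegree ≤ D) :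
    ∑ d ∈ Finset.range (D + 1), intComponent (d : ℤ) p = p := by
  simp only [intComponent_natCast]
  conv_rhs => rw [← sum_homogeneousComponent p]
  refine (Finset.sum_subset (Finset.range_mono (by omega)) fun d _ hd => ?_).symm
  refine homogeneousComponent_eq_zero _ _ ?_
  rw [Finset.mem_range] at hd
  omega

/-- A homogeneous ideal agrees with its saturation in high degrees. -/
theorem exists_forall_mem_of_pow_mul_mem {J : Ideal (MvPolynomial (Fin l) K)}
    (hJ : J.IsHomogeneous (homogeneousSubmodule (Fin l) K)) (N : ℕ) :
    ∃ T : ℕ, ∀ t, T ≤ t → ∀ g : MvPolynomial (Fin l) K, g.IsHomogeneous t →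
      (∀ h ∈ idealOfVars (Fin l) K ^ N, h * g ∈ J) → g ∈ J := by
  -- The colon ideal `(J : 𝔪ᴺ)`. It is finitely generated, and `hcomp` shows that it is homogeneous.
  let J' : Ideal (MvPolynomial (Fin l) K) :=
    { carrier := {g | ∀ h ∈ idealOfVars (Fin l) K ^ N, h * g ∈ J}
      zero_mem' := fun h _ => by rw [mul_zero]; exact J.zero_mem
      add_mem' := fun {a b} ha hb h hh => by
        rw [mul_add]
        exact J.add_mem (ha h hh) (hb h hh)
      smul_mem' := fun c a ha h hh => by
        rw [smul_eq_mul, mul_left_comm]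
        exact J.mul_mem_left _ (ha h hh) }
  have hcomp : ∀ g ∈ J', ∀ t : ℤ, intComponent t g ∈ J' := by
    intro g hg t h hh
    rw [pow_idealOfVars_eq_span] at hh
    refine Submodule.span_induction (p := fun h _ => h * intComponent t g ∈ J) ?_ ?_ ?_ ?_ hh
    · rintro _ ⟨u, hu, rfl⟩
      have hu' : (u.degree : ℕ) = N := hu
      have h1 : (monomial u (1 : K)) ∈ intPiece K l (N : ℤ) :=
        mem_intPiece_natCast.2 (isHomogeneous_monomial 1 hu')
      change monomial u (1 : K) * _ ∈ J
      rw [← intComponent_mul h1]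
      refine intComponent_mem hJ (hg _ ?_) _
      rw [monomial_mem_pow_idealOfVars_iff _ _ one_ne_zero]
      exact hu'.ge
    · rw [zero_mul]
      exact J.zero_mem
    · intro a b _ _ ha hb
      rw [add_mul]
      exact J.add_mem ha hb
    · intro a b _ hb
      rw [smul_eq_mul, mul_assoc]
      exact J.mul_mem_left _ hb
  obtain ⟨G, hG⟩ := IsNoetherian.noetherian J'
  set D := G.sup totalDegree with hD
  -- Generators of `J'` have degree at most `D`. In degree `t ≥ D + N` their homogeneous parts get
  -- multiplied by forms of degree at least `N`, which lie in `𝔪ᴺ`, so the products fall into `J`.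
  have key : ∀ g ∈ J', ∀ (h : MvPolynomial (Fin l) K) (t : ℕ), D + N ≤ t →
      intComponent (t : ℤ) (h * g) ∈ J := by
    intro g hg
    rw [← hG] at hg
    refine Submodule.span_induction (p := fun g _ => ∀ (h : MvPolynomial (Fin l) K) (t : ℕ),
      D + N ≤ t → intComponent (t : ℤ) (h * g) ∈ J) ?_ ?_ ?_ ?_ hg
    · intro b hb h t ht
      have hbJ : b ∈ J' := by
        rw [← hG]
        exact Submodule.subset_span hb
      have hbD : b.totalDegree ≤ D := Finset.le_sup (f := totalDegree) hb
      rw [← sum_intComponent hbD, Finset.mul_sum, map_sum]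
      refine J.sum_mem fun d hd => ?_
      rw [Finset.mem_range] at hd
      rw [mul_comm, ← sub_add_cancel (t : ℤ) d,
        intComponent_mul (intComponent_mem_intPiece _ _), mul_comm]
      exact hcomp b hbJ d _ (intComponent_mem_pow (by omega) h)
    · intro h t _
      rw [mul_zero, map_zero]
      exact J.zero_mem
    · intro a b _ _ ha hb h t ht
      rw [mul_add, map_add]
      exact J.add_mem (ha h t ht) (hb h t ht)
    · intro a b _ hb h t ht
      rw [smul_eq_mul, ← mul_assoc]
      exact hb _ t ht
  refine ⟨D + N, fun t ht g hg h => ?_⟩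
  have := key g h 1 t ht
  rwa [one_mul, intComponent_of_mem (mem_intPiece_natCast.2 hg)] at this

/-- Linear forms outside of finitely many proper subspaces are filter regular on `S ⧸ J`. -/
theorem exists_subspaces_filterRegular {J : Ideal (MvPolynomial (Fin l) K)}
    (hJ : J.IsHomogeneous (homogeneousSubmodule (Fin l) K)) :
    ∃ U : Finset (Submodule K (MvPolynomial (Fin l) K)),
      (∀ W ∈ U, ¬ homogeneousSubmodule (Fin l) K 1 ≤ W) ∧
      ∀ f : MvPolynomial (Fin l) K, (∀ W ∈ U, f ∉ W) →
        ∃ T : ℕ, ∀ t, T ≤ t → ∀ g : MvPolynomial (Fin l) K, g.IsHomogeneous t →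
          f * g ∈ J → g ∈ J := by
  classical
  obtain ⟨s, hs, hprim⟩ := Submodule.isLasker (MvPolynomial (Fin l) K) (MvPolynomial (Fin l) K) J
  have hmem : ∀ g, g ∈ J ↔ ∀ Q ∈ s, g ∈ Q := by
    intro g
    rw [← hs, Submodule.mem_finsetInf]
    rfl
  -- The subspaces to avoid are the radicals of the primary components of `J` whose radical does not
  -- contain `𝔪`. Every other component contains a power of `𝔪` and has no influence in large
  -- degrees.
  refine ⟨(s.filter fun Q : Ideal (MvPolynomial (Fin l) K) =>
    ¬ idealOfVars (Fin l) K ≤ Q.radical).image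
      fun Q : Ideal (MvPolynomial (Fin l) K) => Q.radical.restrictScalars K, ?_, ?_⟩
  · intro W hW hle
    obtain ⟨Q, hQ, rfl⟩ := Finset.mem_image.1 hW
    refine (Finset.mem_filter.1 hQ).2 (Ideal.span_le.2 ?_)
    rintro _ ⟨i, rfl⟩
    exact hle (isHomogeneous_X K i)
  · intro f hf
    have hpow : ∀ Q : Ideal (MvPolynomial (Fin l) K), ∃ n,
        idealOfVars (Fin l) K ≤ Q.radical → idealOfVars (Fin l) K ^ n ≤ Q := by
      intro Q
      by_cases h : idealOfVars (Fin l) K ≤ Q.radical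
      · obtain ⟨n, hn⟩ := Ideal.exists_pow_le_of_le_radical_of_fg h (idealOfVars_fg (Fin l) K)
        exact ⟨n, fun _ => hn⟩
      · exact ⟨0, fun h' => absurd h' h⟩
    choose n hn using hpow
    obtain ⟨T, hT⟩ := exists_forall_mem_of_pow_mul_mem hJ (s.sup n)
    refine ⟨T, fun t ht g hg hfg => hT t ht g hg fun h hh => ?_⟩
    rw [hmem]
    intro Q hQ
    by_cases hm : idealOfVars (Fin l) K ≤ Ideal.radical Q
    · exact Ideal.mul_mem_right _ Q (hn Q hm (Ideal.pow_le_pow_right (Finset.le_sup hQ) hh))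
    · refine Ideal.mul_mem_left Q _ ?_
      have h1 : g * f ∈ Q := by
        rw [mul_comm]
        exact (hmem _).1 hfg Q hQ
      refine ((Ideal.isPrimary_iff.1 (hprim hQ)).2 h1).resolve_right fun h2 => ?_
      exact hf _ (Finset.mem_image.2 ⟨Q, Finset.mem_filter.2 ⟨hQ, hm⟩, rfl⟩) h2

/-- A subspace not contained in any of finitely many subspaces has a vector outside of all of
them. -/
theorem exists_mem_forall_notMem [Infinite K] {E : Type*} [AddCommGroup E] [Module K E]
    (W : Submodule K E) (U : Finset (Submodule K E)) (hU : ∀ N ∈ U, ¬ W ≤ N) :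
    ∃ g ∈ W, ∀ N ∈ U, g ∉ N := by
  classical
  have h : (⊤ : Submodule K W) ∉ U.image fun N => N.comap W.subtype := by
    intro h
    obtain ⟨N, hN, hNt⟩ := Finset.mem_image.1 h
    refine hU N hN fun x hx => ?_
    have : (⟨x, hx⟩ : W) ∈ N.comap W.subtype := by
      rw [hNt]
      trivial
    exact this
  have h1 := Subspace.biUnion_ne_univ_of_top_notMem h
  obtain ⟨g, hg⟩ := (Set.ne_univ_iff_exists_notMem _).1 h1
  refine ⟨g, g.2, fun N hN hgN => hg ?_⟩
  simp only [Set.mem_iUnion]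
  exact ⟨_, Finset.mem_image_of_mem _ hN, hgN⟩

/-- The line `f + c • g` meets each subspace for at most one `c`: two such parameters would put a
nonzero multiple of `g` into it. -/
theorem finite_setOf_add_smul_mem {E : Type*} [AddCommGroup E] [Module K E]
    (U : Finset (Submodule K E)) (f : E) {g : E} (hg : ∀ N ∈ U, g ∉ N) :
    {c : K | ∃ N ∈ U, f + c • g ∈ N}.Finite := by
  have h : {c : K | ∃ N ∈ U, f + c • g ∈ N} = ⋃ N ∈ U, {c : K | f + c • g ∈ N} := by
    ext c
    simp
  rw [h]
  refine U.finite_toSet.biUnion fun N hN => Set.Subsingleton.finite fun a ha b hb => ?_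
  by_contra hab
  refine hg N hN ((Submodule.smul_mem_iff N (sub_ne_zero.2 hab)).1 ?_)
  have := N.sub_mem ha hb
  rwa [add_sub_add_left_eq_sub, ← sub_smul] at this

end Generic

/-! ### Semicontinuity of ranks -/

section Semicontinuity

universe u

variable {K : Type u} [Field K] {l : ℕ}

/-- A polynomial map from the field to an algebra. -/
def IsPolynomialFamily {R : Type*} [CommRing R] [Algebra K R] (f : K → R) : Prop :=
  ∃ P : Polynomial R, ∀ c, f c = P.eval (algebraMap K R c)

namespace IsPolynomialFamily

variable {R : Type*} [CommRing R] [Algebra K R] {f g : K → R}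

theorem const (a : R) : IsPolynomialFamily fun _ : K => a := ⟨Polynomial.C a, by simp⟩

theorem smul_const (a : R) : IsPolynomialFamily fun c : K => c • a :=
  ⟨Polynomial.X * Polynomial.C a, fun c => by
    rw [Polynomial.eval_mul, Polynomial.eval_X, Polynomial.eval_C, ← Algebra.smul_def]⟩

theorem add (hf : IsPolynomialFamily f) (hg : IsPolynomialFamily g) :
    IsPolynomialFamily fun c => f c + g c := by
  obtain ⟨P, hP⟩ := hf
  obtain ⟨Q, hQ⟩ := hg
  exact ⟨P + Q, fun c => by simp only [hP, hQ, Polynomial.eval_add]⟩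

theorem mul (hf : IsPolynomialFamily f) (hg : IsPolynomialFamily g) :
    IsPolynomialFamily fun c => f c * g c := by
  obtain ⟨P, hP⟩ := hf
  obtain ⟨Q, hQ⟩ := hg
  exact ⟨P * Q, fun c => by simp only [hP, hQ, Polynomial.eval_mul]⟩

theorem pow (hf : IsPolynomialFamily f) (n : ℕ) : IsPolynomialFamily fun c => f c ^ n := by
  obtain ⟨P, hP⟩ := hf
  exact ⟨P ^ n, fun c => by simp only [hP, Polynomial.eval_pow]⟩

theorem map {R' : Type*} [CommRing R'] [Algebra K R'] (hf : IsPolynomialFamily f)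
    (L : R →ₗ[K] R') : IsPolynomialFamily fun c => L (f c) := by
  obtain ⟨P, hP⟩ := hf
  refine ⟨∑ n ∈ Finset.range (P.natDegree + 1), Polynomial.C (L (P.coeff n)) * Polynomial.X ^ n,
    fun c => ?_⟩
  beta_reduce
  rw [hP, Polynomial.eval_eq_sum_range, map_sum, Polynomial.eval_finsetSum]
  refine Finset.sum_congr rfl fun n _ => ?_
  rw [Polynomial.eval_mul, Polynomial.eval_C, Polynomial.eval_pow, Polynomial.eval_X,
    ← map_pow, ← map_pow, mul_comm, mul_comm (L _), ← Algebra.smul_def, ← Algebra.smul_def,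
    map_smul]

end IsPolynomialFamily

/-- Linear independence is an open condition in a polynomial family. -/
theorem finite_setOf_not_linearIndependent {R : Type*} [CommRing R] [Algebra K R] {n : ℕ}
    {v : Fin n → K → R} (hv : ∀ b, IsPolynomialFamily (v b))
    (h0 : LinearIndependent K fun b => v b 0) :
    {c : K | ¬ LinearIndependent K fun b => v b c}.Finite := by
  classical
  -- `ψ` reads off coordinates with respect to the vectors at `c = 0`. The determinant of the
  -- coordinates of the vectors at `c` is a polynomial in `c` with value `1` at `0`, and
  -- independence holds wherever it is nonzero.
  obtain ⟨ψ, hψ⟩ := LinearMap.exists_leftInverse_of_injective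
    (Fintype.linearCombination K fun b => v b 0) (LinearMap.ker_eq_bot.2
      (h0.fintypeLinearCombination_injective))
  have hψ0 : ∀ b, ψ (v b 0) = Pi.single b 1 := by
    intro b
    have := LinearMap.congr_fun hψ (Pi.single b 1)
    rwa [LinearMap.comp_apply, Fintype.linearCombination_apply_single, one_smul] at this
  choose Q hQ using fun b a => (hv b).map (LinearMap.proj a ∘ₗ ψ : R →ₗ[K] K)
  let D : Polynomial K := (Matrix.of fun b a => Q b a).det
  have hD : ∀ c, D.eval c = (Matrix.of fun b a => ψ (v b c) a).det := by
    intro c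
    rw [← Polynomial.coe_evalRingHom, RingHom.map_det]
    congr 1
    ext b a
    exact (hQ b a c).symm
  have hD0 : D ≠ 0 := by
    intro h
    have h1 := hD 0
    have h2 : (Matrix.of fun b a => ψ (v b 0) a) = (1 : Matrix (Fin n) (Fin n) K) := by
      ext b a
      rw [Matrix.of_apply, hψ0, Matrix.one_apply, Pi.single_apply]
      simp only [eq_comm]
    rw [h2, h, Polynomial.eval_zero, Matrix.det_one] at h1
    exact zero_ne_one h1
  refine (D.roots.toFinset.finite_toSet).subset fun c hc => ?_
  rw [Finset.mem_coe, Multiset.mem_toFinset, Polynomial.mem_roots hD0, Polynomial.IsRoot.def, hD]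
  by_contra hne
  exact hc (LinearIndependent.of_comp ψ (Matrix.linearIndependent_rows_of_det_ne_zero hne))

/-! ### Full rank in terms of dimensions of graded pieces -/

instance finiteDimensional_homogeneousSubmodule (t : ℕ) :
    FiniteDimensional K (homogeneousSubmodule (Fin l) K t) :=
  Module.Finite.iff_fg.2 (homogeneousSubmodule_fg (Fin l) K t)

/-- The part of degree `t` of an ideal. -/
noncomputable def idealPiece (J : Ideal (MvPolynomial (Fin l) K)) (t : ℕ) :
    Submodule K (MvPolynomial (Fin l) K) :=
  J.restrictScalars K ⊓ homogeneousSubmodule (Fin l) K t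

instance finiteDimensional_idealPiece (J : Ideal (MvPolynomial (Fin l) K)) (t : ℕ) :
    FiniteDimensional K (idealPiece J t) :=
  Submodule.finiteDimensional_of_le (inf_le_right : _ ≤ homogeneousSubmodule (Fin l) K t)

theorem finrank_idealPiece_le (J : Ideal (MvPolynomial (Fin l) K)) (t : ℕ) :
    Module.finrank K (idealPiece J t) ≤ Module.finrank K (homogeneousSubmodule (Fin l) K t) :=
  Submodule.finrank_mono inf_le_right

/-- The dimension of the homogeneous parts is lower semicontinuous in a family of ideals. -/
theorem finite_setOf_finrank_lt {N : K → Ideal (MvPolynomial (Fin l) K)}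
    (hN : ∀ c, (N c).IsHomogeneous (homogeneousSubmodule (Fin l) K))
    (hfam : ∀ v ∈ N 0, ∃ f : K → MvPolynomial (Fin l) K,
      IsPolynomialFamily f ∧ f 0 = v ∧ ∀ c, f c ∈ N c) (t : ℕ) :
    {c : K | Module.finrank K (idealPiece (N c) t) <
      Module.finrank K (idealPiece (N 0) t)}.Finite := by
  -- Each basis vector of the piece at `0` extends to a family inside the ideals. The components of
  -- degree `t` stay independent for almost all `c`, and then the dimension cannot drop.
  let b := Module.finBasis K (idealPiece (N 0) t)
  choose f hf hf0 hfN using fun i => hfam (b i) (b i).2.1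
  have hcomp : ∀ i, IsPolynomialFamily fun c => homogeneousComponent t (f i c) :=
    fun i => (hf i).map (homogeneousComponent t)
  have h0 : LinearIndependent K fun i => homogeneousComponent t (f i 0) := by
    have h1 : (fun i => homogeneousComponent t (f i 0)) = fun i =>
        (idealPiece (N 0) t).subtype (b i) := by
      funext i
      rw [hf0]
      exact homogeneousComponent_eq_self (b i).2.2
    rw [h1]
    exact b.linearIndependent.map' _ (Submodule.ker_subtype _)
  refine (finite_setOf_not_linearIndependent hcomp h0).subset fun c hc hli => ?_
  have h2 := finrank_span_eq_card hli
  have h3 : Submodule.span K (Set.range fun i => homogeneousComponent t (f i c)) ≤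
      idealPiece (N c) t := by
    rw [Submodule.span_le]
    rintro _ ⟨i, rfl⟩
    exact ⟨homogeneousComponent_mem_of_mem (hN c) (hfN i c) t,
      homogeneousComponent_isHomogeneous _ _⟩
  have h4 := Submodule.finrank_mono h3
  rw [h2, Fintype.card_fin] at h4
  exact absurd hc (not_lt.2 h4)

/-- Multiplication by `f` from degree `j` to degree `j + s` has full rank on `S ⧸ J`. -/
def FullRank (J : Ideal (MvPolynomial (Fin l) K)) (f : MvPolynomial (Fin l) K) (j s : ℕ) : Prop :=
  (∀ x : MvPolynomial (Fin l) K, x.IsHomogeneous j → f * x ∈ J → x ∈ J) ∨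
    ∀ y : MvPolynomial (Fin l) K, y.IsHomogeneous (j + s) →
      ∃ x : MvPolynomial (Fin l) K, x.IsHomogeneous j ∧ y - f * x ∈ J

theorem exists_of_mem_sup_span {J : Ideal (MvPolynomial (Fin l) K)}
    (hJ : J.IsHomogeneous (homogeneousSubmodule (Fin l) K)) {f : MvPolynomial (Fin l) K} {s : ℕ}
    (hf : f.IsHomogeneous s) {t : ℕ} {y : MvPolynomial (Fin l) K} (hy : y.IsHomogeneous t)
    (h : y ∈ J ⊔ Ideal.span {f}) : ∃ x, y - f * intComponent ((t : ℤ) - s) x ∈ J := by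
  obtain ⟨a, ha, b, hb, rfl⟩ := Submodule.mem_sup.1 h
  obtain ⟨x, rfl⟩ := Ideal.mem_span_singleton'.1 hb
  refine ⟨x, ?_⟩
  have h1 := intComponent_mul (mem_intPiece_natCast.2 hf) ((t : ℤ) - s) x
  rw [sub_add_cancel] at h1
  rw [← h1, ← intComponent_of_mem (mem_intPiece_natCast.2 hy), map_add, mul_comm x,
    add_sub_cancel_right]
  exact intComponent_mem hJ ha _

theorem exists_isHomogeneous_of_mem_sup_span {J : Ideal (MvPolynomial (Fin l) K)}
    (hJ : J.IsHomogeneous (homogeneousSubmodule (Fin l) K)) {f : MvPolynomial (Fin l) K} {s : ℕ}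
    (hf : f.IsHomogeneous s) {j : ℕ} {y : MvPolynomial (Fin l) K} (hy : y.IsHomogeneous (j + s))
    (h : y ∈ J ⊔ Ideal.span {f}) :
    ∃ x : MvPolynomial (Fin l) K, x.IsHomogeneous j ∧ y - f * x ∈ J := by
  obtain ⟨x, hx⟩ := exists_of_mem_sup_span hJ hf hy h
  refine ⟨_, ?_, hx⟩
  rw [← mem_intPiece_natCast]
  convert intComponent_mem_intPiece (j : ℤ) x using 2
  push_cast
  ring_nf

theorem mem_sup_span_of_sub_mem {J : Ideal (MvPolynomial (Fin l) K)} {f x y : MvPolynomial (Fin l) K}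
    (h : y - f * x ∈ J) : y ∈ J ⊔ Ideal.span {f} := by
  rw [← sub_add_cancel y (f * x)]
  exact Submodule.add_mem_sup h (Ideal.mul_mem_right _ _ (Ideal.mem_span_singleton_self f))

theorem idealPiece_sup_span_of_lt {J : Ideal (MvPolynomial (Fin l) K)}
    (hJ : J.IsHomogeneous (homogeneousSubmodule (Fin l) K)) {f : MvPolynomial (Fin l) K} {s : ℕ}
    (hf : f.IsHomogeneous s) {t : ℕ} (ht : t < s) :
    idealPiece (J ⊔ Ideal.span {f}) t = idealPiece J t := by
  refine le_antisymm ?_ fun y hy => ⟨Ideal.mem_sup_left hy.1, hy.2⟩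
  rintro y ⟨hy, hyt⟩
  obtain ⟨x, hx⟩ := exists_of_mem_sup_span hJ hf hyt hy
  have h0 : intComponent ((t : ℤ) - s) x = 0 := by
    rw [intComponent, if_neg (by omega), LinearMap.zero_apply]
  rw [h0, mul_zero, sub_zero] at hx
  exact ⟨hx, hyt⟩

/-- The kernel of multiplication by `f` on the part of degree `j` of `S ⧸ J`, lifted to `S`. -/
noncomputable def mulKernel (J : Ideal (MvPolynomial (Fin l) K)) (f : MvPolynomial (Fin l) K) (j : ℕ) :
    Submodule K (MvPolynomial (Fin l) K) :=
  (J.restrictScalars K).comap (LinearMap.mulLeft K f) ⊓ homogeneousSubmodule (Fin l) K j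

instance finiteDimensional_mulKernel (J : Ideal (MvPolynomial (Fin l) K))
    (f : MvPolynomial (Fin l) K) (j : ℕ) : FiniteDimensional K (mulKernel J f j) :=
  Submodule.finiteDimensional_of_le (inf_le_right : _ ≤ homogeneousSubmodule (Fin l) K j)

theorem idealPiece_le_mulKernel (J : Ideal (MvPolynomial (Fin l) K)) (f : MvPolynomial (Fin l) K)
    (j : ℕ) : idealPiece J j ≤ mulKernel J f j := fun _ hx => ⟨J.mul_mem_left f hx.1, hx.2⟩

/-- For `f ≠ 0` this is the dimension formula for `J_{j+s} + f·S_j`, which is the piece of `J +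
(f)`; the intersection of the two summands is `f` times `mulKernel`. -/
theorem finrank_sup_span {J : Ideal (MvPolynomial (Fin l) K)}
    (hJ : J.IsHomogeneous (homogeneousSubmodule (Fin l) K)) {f : MvPolynomial (Fin l) K} {s : ℕ}
    (hf : f.IsHomogeneous s) (j : ℕ) :
    Module.finrank K (idealPiece (J ⊔ Ideal.span {f}) (j + s)) +
        Module.finrank K (mulKernel J f j) =
      Module.finrank K (idealPiece J (j + s)) +
        Module.finrank K (homogeneousSubmodule (Fin l) K j) := by
  rcases eq_or_ne f 0 with rfl | hf0
  · have h1 : mulKernel J 0 j = homogeneousSubmodule (Fin l) K j :=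
      le_antisymm inf_le_right fun x hx => ⟨by simp, hx⟩
    have h2 : J ⊔ Ideal.span {0} = J := by simp
    rw [h1, h2]
  · set φ := LinearMap.mulLeft K f with hφ
    have hinj : Function.Injective φ := mul_right_injective₀ hf0
    have hfr : ∀ W : Submodule K (MvPolynomial (Fin l) K),
        Module.finrank K (W.map φ) = Module.finrank K W := fun W =>
      (Submodule.equivMapOfInjective φ hinj W).finrank_eq.symm
    have h1 : idealPiece (J ⊔ Ideal.span {f}) (j + s) =
        idealPiece J (j + s) ⊔ (homogeneousSubmodule (Fin l) K j).map φ := by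
      refine le_antisymm ?_ (sup_le ?_ ?_)
      · rintro y ⟨hy, hyt⟩
        obtain ⟨x, hx, hxy⟩ := exists_isHomogeneous_of_mem_sup_span hJ hf hyt hy
        rw [← sub_add_cancel y (f * x)]
        refine Submodule.add_mem_sup ⟨hxy, ?_⟩ ⟨x, hx, rfl⟩
        refine Submodule.sub_mem _ hyt ?_
        rw [add_comm]
        exact hf.mul hx
      · exact fun y hy => ⟨Ideal.mem_sup_left hy.1, hy.2⟩
      · rintro _ ⟨x, hx, rfl⟩
        refine ⟨Ideal.mem_sup_right (Ideal.mul_mem_right _ _ (Ideal.mem_span_singleton_self f)), ?_⟩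
        rw [add_comm]
        exact hf.mul hx
    have h2 : idealPiece J (j + s) ⊓ (homogeneousSubmodule (Fin l) K j).map φ =
        (mulKernel J f j).map φ := by
      refine le_antisymm ?_ ?_
      · rintro _ ⟨hy, x, hx, rfl⟩
        exact ⟨x, ⟨hy.1, hx⟩, rfl⟩
      · rintro _ ⟨x, hx, rfl⟩
        refine ⟨⟨hx.1, ?_⟩, x, hx.2, rfl⟩
        rw [add_comm]
        exact hf.mul hx.2
    have h3 := Submodule.finrank_sup_add_finrank_inf_eq (idealPiece J (j + s))
      ((homogeneousSubmodule (Fin l) K j).map φ)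
    rwa [← h1, h2, hfr, hfr] at h3

/-- Injectivity means that `mulKernel` is no larger than `J_j`, surjectivity that `J + (f)` fills
its degree. Each is a lower bound for the dimension of a piece of `J + (f)`, which is the shape
needed for semicontinuity. -/
theorem fullRank_iff {J : Ideal (MvPolynomial (Fin l) K)}
    (hJ : J.IsHomogeneous (homogeneousSubmodule (Fin l) K)) {f : MvPolynomial (Fin l) K} {s : ℕ}
    (hf : f.IsHomogeneous s) (j : ℕ) :
    FullRank J f j s ↔
      (Module.finrank K (idealPiece J (j + s)) +
          Module.finrank K (homogeneousSubmodule (Fin l) K j) ≤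
        Module.finrank K (idealPiece (J ⊔ Ideal.span {f}) (j + s)) +
          Module.finrank K (idealPiece J j)) ∨
      Module.finrank K (homogeneousSubmodule (Fin l) K (j + s)) ≤
        Module.finrank K (idealPiece (J ⊔ Ideal.span {f}) (j + s)) := by
  have h := finrank_sup_span hJ hf j
  refine or_congr ?_ ?_
  · constructor
    · intro hi
      have h1 : mulKernel J f j = idealPiece J j :=
        le_antisymm (fun x hx => ⟨hi x hx.2 hx.1, hx.2⟩) (idealPiece_le_mulKernel J f j)
      rw [h1] at h
      exact h.ge
    · intro hle x hx hfx
      have h1 : idealPiece J j = mulKernel J f j :=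
        Submodule.eq_of_le_of_finrank_le (idealPiece_le_mulKernel J f j) (by omega)
      have h2 : x ∈ mulKernel J f j := ⟨hfx, hx⟩
      rw [← h1] at h2
      exact h2.1
  · constructor
    · intro hs
      refine Submodule.finrank_mono fun y hy => ⟨?_, hy⟩
      obtain ⟨x, -, hxy⟩ := hs y hy
      exact mem_sup_span_of_sub_mem hxy
    · intro hle y hy
      have h1 : idealPiece (J ⊔ Ideal.span {f}) (j + s) = homogeneousSubmodule (Fin l) K (j + s) :=
        Submodule.eq_of_le_of_finrank_le inf_le_right hle
      have h2 : y ∈ idealPiece (J ⊔ Ideal.span {f}) (j + s) := by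
        rw [h1]
        exact hy
      exact exists_isHomogeneous_of_mem_sup_span hJ hf hy h2.1

/-- The ideal generated by `I` and the first `p` terms of a sequence. -/
noncomputable def seqIdeal (I : Ideal (MvPolynomial (Fin l) K)) (s : ℕ → MvPolynomial (Fin l) K) (p : ℕ) :
    Ideal (MvPolynomial (Fin l) K) :=
  I ⊔ Ideal.span (s '' Set.Iio p)

theorem seqIdeal_zero (I : Ideal (MvPolynomial (Fin l) K)) (s : ℕ → MvPolynomial (Fin l) K) :
    seqIdeal I s 0 = I := by simp [seqIdeal]

theorem seqIdeal_succ (I : Ideal (MvPolynomial (Fin l) K)) (s : ℕ → MvPolynomial (Fin l) K)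
    (p : ℕ) : seqIdeal I s (p + 1) = seqIdeal I s p ⊔ Ideal.span {s p} := by
  rw [seqIdeal, seqIdeal, sup_assoc, ← Ideal.span_union]
  congr 2
  ext x
  simp only [Set.mem_image, Set.mem_Iio, Set.mem_union, Set.mem_singleton_iff]
  constructor
  · rintro ⟨j, hj, rfl⟩
    rcases Nat.lt_succ_iff_lt_or_eq.1 hj with h | rfl
    · exact Or.inl ⟨j, h, rfl⟩
    · exact Or.inr rfl
  · rintro (⟨j, hj, rfl⟩ | rfl)
    · exact ⟨j, by omega, rfl⟩
    · exact ⟨p, by omega, rfl⟩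

theorem isHomogeneous_span_singleton {f : MvPolynomial (Fin l) K} {d : ℕ} (hf : f.IsHomogeneous d) :
    (Ideal.span {f}).IsHomogeneous (homogeneousSubmodule (Fin l) K) :=
  Ideal.homogeneous_span _ _ fun x hx => ⟨d, by rw [Set.mem_singleton_iff.1 hx]; exact hf⟩

theorem isHomogeneous_seqIdeal {I : Ideal (MvPolynomial (Fin l) K)}
    (hI : I.IsHomogeneous (homogeneousSubmodule (Fin l) K)) {s : ℕ → MvPolynomial (Fin l) K}
    (hs : ∀ p, (s p).IsHomogeneous 1) (p : ℕ) :
    (seqIdeal I s p).IsHomogeneous (homogeneousSubmodule (Fin l) K) := by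
  refine hI.sup (Ideal.homogeneous_span _ _ ?_)
  rintro _ ⟨j, -, rfl⟩
  exact ⟨1, hs j⟩

/-- The elements that extend to a polynomial family inside the ideals form an ideal themselves, so
it suffices to extend the generators. -/
theorem exists_family_mem_sup_span (I : Ideal (MvPolynomial (Fin l) K))
    {s : K → ℕ → MvPolynomial (Fin l) K} (hs : ∀ j, IsPolynomialFamily fun c => s c j) (i e : ℕ)
    {v : MvPolynomial (Fin l) K} (hv : v ∈ seqIdeal I (s 0) i ⊔ Ideal.span {s 0 i ^ e}) :
    ∃ f : K → MvPolynomial (Fin l) K, IsPolynomialFamily f ∧ f 0 = v ∧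
      ∀ c, f c ∈ seqIdeal I (s c) i ⊔ Ideal.span {s c i ^ e} := by
  let T : Ideal (MvPolynomial (Fin l) K) :=
    { carrier := {v | ∃ f : K → MvPolynomial (Fin l) K, IsPolynomialFamily f ∧ f 0 = v ∧
        ∀ c, f c ∈ seqIdeal I (s c) i ⊔ Ideal.span {s c i ^ e}}
      zero_mem' := ⟨fun _ => 0, .const 0, rfl, fun c => zero_mem _⟩
      add_mem' := by
        rintro _ _ ⟨f, hf, rfl, hfm⟩ ⟨g, hg, rfl, hgm⟩
        exact ⟨fun c => f c + g c, hf.add hg, rfl, fun c => add_mem (hfm c) (hgm c)⟩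
      smul_mem' := by
        rintro a _ ⟨f, hf, rfl, hfm⟩
        exact ⟨fun c => a * f c, (IsPolynomialFamily.const a).mul hf, rfl,
          fun c => Ideal.mul_mem_left _ _ (hfm c)⟩ }
  have hT : seqIdeal I (s 0) i ⊔ Ideal.span {s 0 i ^ e} ≤ T := by
    refine sup_le (sup_le ?_ ?_) ?_
    · exact fun a ha => ⟨fun _ => a, .const a, rfl,
        fun c => Ideal.mem_sup_left (Ideal.mem_sup_left ha)⟩
    · rw [Ideal.span_le]
      rintro _ ⟨j, hj, rfl⟩
      exact ⟨fun c => s c j, hs j, rfl, fun c =>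
        Ideal.mem_sup_left (Ideal.mem_sup_right (Ideal.subset_span ⟨j, hj, rfl⟩))⟩
    · rw [Ideal.span_le, Set.singleton_subset_iff]
      exact ⟨fun c => s c i ^ e, (hs i).pow e, rfl,
        fun c => Ideal.mem_sup_right (Ideal.mem_span_singleton_self _)⟩
  exact hT hv

/-- The sequence `s 0, …, s (k - 1)` has the Lefschetz property on `S ⧸ I`, for the powers in `Q`,
as far as the degrees up to `r` are concerned. -/
def IsLefschetzUpTo (I : Ideal (MvPolynomial (Fin l) K)) (Q : ℕ → Prop) (k r : ℕ)
    (s : ℕ → MvPolynomial (Fin l) K) : Prop :=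
  ∀ i < k, ∀ j e, Q e → j + e ≤ r → FullRank (seqIdeal I s i) (s i ^ e) j e

/-- The Lefschetz property is an open condition in a polynomial family of sequences. -/
theorem finite_setOf_not_isLefschetzUpTo {I : Ideal (MvPolynomial (Fin l) K)}
    (hI : I.IsHomogeneous (homogeneousSubmodule (Fin l) K)) {Q : ℕ → Prop} (hQ : Q 1) {k r : ℕ}
    {s : K → ℕ → MvPolynomial (Fin l) K} (hs : ∀ j, IsPolynomialFamily fun c => s c j)
    (hhom : ∀ c j, (s c j).IsHomogeneous 1) (h0 : IsLefschetzUpTo I Q k r (s 0)) :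
    {c | ¬ IsLefschetzUpTo I Q k r (s c)}.Finite := by
  let N : ℕ → ℕ → K → Ideal (MvPolynomial (Fin l) K) := fun i e c =>
    seqIdeal I (s c) i ⊔ Ideal.span {s c i ^ e}
  have hpow : ∀ c i e, (s c i ^ e).IsHomogeneous e := fun c i e => by
    simpa using (hhom c i).pow e
  -- The bound `r` leaves finitely many triples `(i, e, t)`. Without it the exceptional set could be
  -- infinite.
  have hfin : (⋃ i ∈ Finset.range k, ⋃ e ∈ Finset.range (r + 1), ⋃ t ∈ Finset.range (r + 1),
      {c : K | Module.finrank K (idealPiece (N i e c) t) <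
        Module.finrank K (idealPiece (N i e 0) t)}).Finite := by
    refine (Finset.finite_toSet _).biUnion fun i _ => (Finset.finite_toSet _).biUnion fun e _ =>
      (Finset.finite_toSet _).biUnion fun t _ => finite_setOf_finrank_lt (fun c => ?_) ?_ t
    · exact (isHomogeneous_seqIdeal hI (hhom c) i).sup (isHomogeneous_span_singleton (hpow c i e))
    · exact fun v hv => exists_family_mem_sup_span I hs i e hv
  refine hfin.subset fun c hc => ?_
  by_contra hcn
  have hsemi : ∀ i < k, ∀ e ≤ r, ∀ t ≤ r, Module.finrank K (idealPiece (N i e 0) t) ≤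
      Module.finrank K (idealPiece (N i e c) t) := by
    intro i hi e he t ht
    by_contra hlt
    refine hcn ?_
    simp only [Set.mem_iUnion, Finset.mem_range]
    exact ⟨i, hi, e, by omega, t, by omega, not_le.1 hlt⟩
  have hN1 : ∀ i c, N i 1 c = seqIdeal I (s c) (i + 1) := fun i c => by
    rw [seqIdeal_succ]
    simp only [N, pow_one]
  -- The criterion `fullRank_iff` also contains dimensions of `J` itself, for which an inequality is
  -- not enough. They agree at `c` and at `0`: full rank with exponent `1` makes the pieces of `J +
  -- (f)` at `0` as large as the earlier dimensions permit, so those at `c` cannot exceed them.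
  have heq : ∀ i ≤ k, ∀ t ≤ r, Module.finrank K (idealPiece (seqIdeal I (s c) i) t) =
      Module.finrank K (idealPiece (seqIdeal I (s 0) i) t) := by
    intro i
    induction i with
    | zero =>
      intro _ t _
      rw [seqIdeal_zero, seqIdeal_zero]
    | succ i ih =>
      intro hi t ht
      rcases Nat.eq_zero_or_pos t with rfl | htp
      · rw [seqIdeal_succ, seqIdeal_succ,
          idealPiece_sup_span_of_lt (isHomogeneous_seqIdeal hI (hhom c) i) (hhom c i) one_pos,
          idealPiece_sup_span_of_lt (isHomogeneous_seqIdeal hI (hhom 0) i) (hhom 0 i) one_pos]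
        exact ih (by omega) 0 ht
      · obtain ⟨j, rfl⟩ : ∃ j, t = j + 1 := ⟨t - 1, by omega⟩
        have h1 := hsemi i (by omega) 1 (by omega) (j + 1) ht
        rw [hN1, hN1] at h1
        refine le_antisymm ?_ h1
        have h2 := (fullRank_iff (isHomogeneous_seqIdeal hI (hhom 0) i) (hpow 0 i 1) j).1
          (h0 i (by omega) j 1 hQ ht)
        have h3 := finrank_sup_span (isHomogeneous_seqIdeal hI (hhom c) i) (hpow c i 1) j
        have h4 := Submodule.finrank_mono
          (idealPiece_le_mulKernel (seqIdeal I (s c) i) (s c i ^ 1) j)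
        have h5 := finrank_idealPiece_le (seqIdeal I (s c) (i + 1)) (j + 1)
        rw [pow_one, ← seqIdeal_succ] at h2 h3
        rw [pow_one] at h4
        have h6 := ih (by omega) j (by omega)
        have h7 := ih (by omega) (j + 1) ht
        omega
  refine hc fun i hi j e he hje => ?_
  have h1 := (fullRank_iff (isHomogeneous_seqIdeal hI (hhom 0) i) (hpow 0 i e) j).1
    (h0 i hi j e he hje)
  refine (fullRank_iff (isHomogeneous_seqIdeal hI (hhom c) i) (hpow c i e) j).2 ?_
  have h2 := hsemi i hi e (by omega) (j + e) hje
  have h3 := heq i hi.le j (by omega)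
  have h4 := heq i hi.le (j + e) hje
  simp only [N] at h2
  omega

end Semicontinuity

/-! ### Lefschetz properties of quotients of polynomial rings -/

section Main

universe u

variable {K : Type u} [Field K] {l : ℕ}

theorem not_linearForms_le_span {n : ℕ} (hn : n < l) (s : ℕ → MvPolynomial (Fin l) K) :
    ¬ homogeneousSubmodule (Fin l) K 1 ≤ Submodule.span K (s '' Set.Iio n) := by
  classical
  intro hle
  have himg : s '' Set.Iio n = ((Finset.range n).image s : Finset (MvPolynomial (Fin l) K)) := by
    rw [Finset.coe_image, Finset.coe_range]
  rw [himg] at hle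
  have h1 := Submodule.finrank_mono hle
  have h2 := finrank_span_finset_le_card (R := K) ((Finset.range n).image s)
  have h3 : ((Finset.range n).image s).card ≤ n := by
    simpa using Finset.card_image_le (s := Finset.range n) (f := s)
  rw [finrank_linearForms] at h1
  have h4 : Module.finrank K (Submodule.span K
    (((Finset.range n).image s : Finset (MvPolynomial (Fin l) K)) :
      Set (MvPolynomial (Fin l) K))) ≤ ((Finset.range n).image s).card := h2
  omega

/-- The term `s p` is not a linear combination of its predecessors, and it is filter regular on
the quotient by `I` and its predecessors. -/
def IsGenericAt (I : Ideal (MvPolynomial (Fin l) K)) (s : ℕ → MvPolynomial (Fin l) K) (p : ℕ) :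
    Prop :=
  s p ∉ Submodule.span K (s '' Set.Iio p) ∧
    ∃ T : ℕ, ∀ t, T ≤ t → ∀ g : MvPolynomial (Fin l) K, g.IsHomogeneous t →
      s p * g ∈ seqIdeal I s p → g ∈ seqIdeal I s p

/-- A sequence of linear forms with the Lefschetz property up to a degree can be replaced by a
generic one. -/
theorem exists_generic_isLefschetzUpTo [Infinite K] {I : Ideal (MvPolynomial (Fin l) K)}
    (hI : I.IsHomogeneous (homogeneousSubmodule (Fin l) K)) {Q : ℕ → Prop} (hQ : Q 1) {k r : ℕ}
    {s : ℕ → MvPolynomial (Fin l) K} (hs : ∀ p, (s p).IsHomogeneous 1)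
    (hL : IsLefschetzUpTo I Q k r s) (n : ℕ) (hn : n ≤ l) :
    ∃ s' : ℕ → MvPolynomial (Fin l) K, (∀ p, (s' p).IsHomogeneous 1) ∧
      IsLefschetzUpTo I Q k r s' ∧ ∀ p < n, IsGenericAt I s' p := by
  classical
  induction n with
  | zero => exact ⟨s, hs, hL, fun p hp => absurd hp (Nat.not_lt_zero p)⟩
  | succ n ih =>
    obtain ⟨s, hs, hL, hgen⟩ := ih (by omega)
    obtain ⟨U, hU, hUreg⟩ := exists_subspaces_filterRegular (isHomogeneous_seqIdeal hI hs n)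
    -- A direction `g` outside all the forbidden subspaces: moving the term `n` along it escapes
    -- them for almost every parameter, whatever `s n` is.
    obtain ⟨g, hg, hgU⟩ := exists_mem_forall_notMem (homogeneousSubmodule (Fin l) K 1)
      (insert (Submodule.span K (s '' Set.Iio n)) U) (by
        intro W hW
        rcases Finset.mem_insert.1 hW with rfl | hW
        · exact not_linearForms_le_span (by omega) s
        · exact hU W hW)
    let σ : K → ℕ → MvPolynomial (Fin l) K := fun c => Function.update s n (s n + c • g)
    have hσn : ∀ c, σ c n = s n + c • g := fun c => Function.update_self _ _ _
    have hσ : ∀ c j, j ≠ n → σ c j = s j := fun c j hj => Function.update_of_ne hj _ _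
    have hσ0 : σ 0 = s := by
      change Function.update s n (s n + (0 : K) • g) = s
      rw [zero_smul, add_zero, Function.update_eq_self]
    have hhom : ∀ c j, (σ c j).IsHomogeneous 1 := by
      intro c j
      rcases eq_or_ne j n with rfl | hj
      · rw [hσn]
        exact Submodule.add_mem _ (hs j) (Submodule.smul_mem _ c hg)
      · rw [hσ c j hj]
        exact hs j
    have hfam : ∀ j, IsPolynomialFamily fun c => σ c j := by
      intro j
      rcases eq_or_ne j n with rfl | hj
      · simp only [hσn]
        exact (IsPolynomialFamily.const _).add (IsPolynomialFamily.smul_const g)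
      · simp only [hσ _ j hj]
        exact IsPolynomialFamily.const _
    have hfin := (finite_setOf_not_isLefschetzUpTo hI hQ hfam hhom (by rw [hσ0]; exact hL)).union
      (finite_setOf_add_smul_mem _ (s n) hgU)
    obtain ⟨c, hc⟩ := hfin.exists_notMem
    rw [Set.mem_union, not_or] at hc
    have hcU : ∀ W ∈ insert (Submodule.span K (s '' Set.Iio n)) U, s n + c • g ∉ W :=
      fun W hW hmem => hc.2 ⟨W, hW, hmem⟩
    -- Genericity at `p` involves only the terms up to `p`, so changing the term `n` does not
    -- disturb the earlier positions.
    have himg : ∀ p ≤ n, σ c '' Set.Iio p = s '' Set.Iio p := fun p hp =>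
      Set.image_congr fun j hj => hσ c j (ne_of_lt (lt_of_lt_of_le hj hp))
    refine ⟨σ c, hhom c, not_not.1 hc.1, fun p hp => ?_⟩
    rcases Nat.lt_succ_iff_lt_or_eq.1 hp with hp | rfl
    · have := hgen p hp
      unfold IsGenericAt seqIdeal at this ⊢
      rwa [himg p hp.le, hσ c p hp.ne]
    · unfold IsGenericAt seqIdeal
      rw [himg p le_rfl, hσn]
      exact ⟨hcU _ (Finset.mem_insert_self _ _),
        hUreg _ fun W hW => hcU W (Finset.mem_insert_of_mem hW)⟩

/-! ### From bounded degrees to all degrees -/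

theorem pow_idealOfVars_le {t : ℕ} {N : Ideal (MvPolynomial (Fin l) K)}
    (h : ∀ y : MvPolynomial (Fin l) K, y.IsHomogeneous t → y ∈ N) :
    idealOfVars (Fin l) K ^ t ≤ N := by
  rw [pow_idealOfVars_eq_span, Ideal.span_le]
  rintro _ ⟨u, hu, rfl⟩
  exact h _ (isHomogeneous_monomial 1 hu)

theorem isHomogeneous_mem_pow {t n : ℕ} (hn : n ≤ t) {y : MvPolynomial (Fin l) K}
    (hy : y.IsHomogeneous t) : y ∈ idealOfVars (Fin l) K ^ n := by
  have := intComponent_mem_pow (t := t) (by exact_mod_cast hn) y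
  rwa [intComponent_of_mem (mem_intPiece_natCast.2 hy)] at this

/-- If multiplication by `f` is injective from the degree `r` on, then full rank up to the degree
`r` implies full rank in all degrees. -/
theorem fullRank_of_injective {J : Ideal (MvPolynomial (Fin l) K)}
    (hJ : J.IsHomogeneous (homogeneousSubmodule (Fin l) K)) {f : MvPolynomial (Fin l) K}
    (hf : f.IsHomogeneous 1) {r : ℕ}
    (hinj : ∀ t, r ≤ t → ∀ g : MvPolynomial (Fin l) K, g.IsHomogeneous t → f * g ∈ J → g ∈ J)
    {Q : ℕ → Prop} (hQ : ∀ e e', Q e → 1 ≤ e' → e' ≤ e → Q e')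
    (hlow : ∀ j e, Q e → j + e ≤ r → FullRank J (f ^ e) j e) (j e : ℕ) (he : Q e) :
    FullRank J (f ^ e) j e := by
  have hpow : ∀ n, (f ^ n).IsHomogeneous n := fun n => by simpa using hf.pow n
  have hinj' : ∀ n t, r ≤ t → ∀ g : MvPolynomial (Fin l) K, g.IsHomogeneous t →
      f ^ n * g ∈ J → g ∈ J := by
    intro n
    induction n with
    | zero =>
      intro t _ g _ h
      rwa [pow_zero, one_mul] at h
    | succ n ih =>
      intro t ht g hg h
      rw [pow_succ', mul_assoc] at h
      exact ih t ht g hg (hinj (n + t) (by omega) _ ((hpow n).mul hg) h)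
  rcases le_or_gt r j with hj | hj
  · exact Or.inl (hinj' e j hj)
  rcases le_or_gt (j + e) r with hje | hje
  · exact hlow j e he hje
  -- The remaining case is `j < r < j + e`. The map factors through degree `r`, with `a + 1 = r - j`
  -- steps up to `r` and `n` steps beyond it.
  obtain ⟨a, rfl⟩ : ∃ a, r = j + (a + 1) := ⟨r - j - 1, by omega⟩
  obtain ⟨n, rfl⟩ : ∃ n, e = n + (a + 1) := ⟨e - (a + 1), by omega⟩
  rcases hlow j (a + 1) (hQ _ _ he (by omega) (by omega)) le_rfl with h | h
  · refine Or.inl fun x hx hfx => h x hx ?_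
    rw [pow_add, mul_assoc] at hfx
    refine hinj' n _ le_rfl _ ?_ hfx
    rw [add_comm j]
    exact (hpow _).mul hx
  · right
    -- Surjectivity onto degree `r` makes `S/(J + (f))` vanish in degree `r`, hence in all higher
    -- degrees, so every further multiplication by `f` is surjective too.
    have hideal : idealOfVars (Fin l) K ^ (j + (a + 1)) ≤ J ⊔ Ideal.span {f} := by
      refine pow_idealOfVars_le fun y hy => ?_
      obtain ⟨x, -, hxy⟩ := h y hy
      rw [pow_succ', mul_assoc] at hxy
      exact mem_sup_span_of_sub_mem hxy
    clear he hje
    induction n with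
    | zero => simpa using h
    | succ n ih =>
      intro y hy
      obtain ⟨x', hx', hyx'⟩ := exists_isHomogeneous_of_mem_sup_span (j := j + (n + (a + 1))) hJ hf
        (by convert hy using 1; omega) (hideal (isHomogeneous_mem_pow (by omega) hy))
      obtain ⟨x, hx, hxx'⟩ := ih x' hx'
      refine ⟨x, hx, ?_⟩
      have h1 : y - f ^ (n + 1 + (a + 1)) * x = (y - f * x') + f * (x' - f ^ (n + (a + 1)) * x) := by
        rw [add_right_comm, pow_succ']
        ring
      rw [h1]
      exact J.add_mem hyx' (J.mul_mem_left _ hxx')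

/-- The Lefschetz property up to the regularity implies the Lefschetz property, for suitable linear
forms. -/
theorem exists_fullRank_of_isLefschetzUpTo [Infinite K] {I : Ideal (MvPolynomial (Fin l) K)}
    (hI : I.IsHomogeneous (homogeneousSubmodule (Fin l) K)) {Q : ℕ → Prop} (hQ1 : Q 1)
    (hQ : ∀ e e', Q e → 1 ≤ e' → e' ≤ e → Q e') {k : ℕ} (hk : k ≤ l)
    {s : ℕ → MvPolynomial (Fin l) K} (hs : ∀ p, (s p).IsHomogeneous 1)
    (hL : IsLefschetzUpTo I Q k (castelnuovoMumfordRegularity I hI) s) :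
    ∃ s' : ℕ → MvPolynomial (Fin l) K, (∀ p, (s' p).IsHomogeneous 1) ∧
      ∀ i < k, ∀ j e, Q e → FullRank (seqIdeal I s' i) (s' i ^ e) j e := by
  -- All `l` terms are made generic although only `k` are tested: the Koszul argument starts from a
  -- full system of coordinates.
  obtain ⟨s, hs, hL, hgen⟩ := exists_generic_isLefschetzUpTo hI hQ1 hs hL l le_rfl
  refine ⟨s, hs, fun i hi j e he => ?_⟩
  refine fullRank_of_injective (isHomogeneous_seqIdeal hI hs i) (hs i) (fun t ht g hg hfg => ?_) hQ
    (hL i hi) j e he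
  exact mem_of_mul_mem_of_regularity_le hI (s := fun p => ⟨s p, hs p⟩)
    (fun p hp => (hgen p hp).1) (fun p hp => (hgen p hp).2) (lt_of_lt_of_le hi hk) ht hg hfg

/-! ### Lifting the Lefschetz properties from iterated quotients to `S` -/

theorem mk_mk_eq_zero_iff {I : Ideal (MvPolynomial (Fin l) K)} {s : ℕ → MvPolynomial (Fin l) K}
    {k : ℕ} {ℓ : Fin k → MvPolynomial (Fin l) K ⧸ I} (hℓ : ∀ j, ℓ j = Ideal.Quotient.mk I (s j))
    (i : Fin k) (x : MvPolynomial (Fin l) K) :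
    Ideal.Quotient.mk (Ideal.span {x | ∃ j < i, ℓ j = x}) (Ideal.Quotient.mk I x) = 0 ↔
      x ∈ seqIdeal I s i := by
  have h : Ideal.span {x | ∃ j < i, ℓ j = x} =
      (Ideal.span (s '' Set.Iio (i : ℕ))).map (Ideal.Quotient.mk I) := by
    rw [Ideal.map_span]
    congr 1
    ext x
    constructor
    · rintro ⟨j, hj, rfl⟩
      exact ⟨s j, ⟨j, hj, rfl⟩, (hℓ j).symm⟩
    · rintro ⟨_, ⟨j, hj, rfl⟩, rfl⟩
      exact ⟨⟨j, lt_trans hj i.2⟩, hj, hℓ _⟩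
  rw [Ideal.Quotient.eq_zero_iff_mem, h, Ideal.mem_quotient_iff_mem_sup, sup_comm]
  rfl

theorem mulFullRank_iff_of_map {T : Type*} [CommRing T] [Algebra K T] {𝒜 : ℕ → Submodule K T}
    (q : MvPolynomial (Fin l) K →+* T) {J : Ideal (MvPolynomial (Fin l) K)}
    (hq : ∀ x, q x = 0 ↔ x ∈ J)
    (hmem : ∀ t z, z ∈ 𝒜 t ↔ ∃ x : MvPolynomial (Fin l) K, x.IsHomogeneous t ∧ q x = z)
    (f : MvPolynomial (Fin l) K) (j e : ℕ) :
    MulFullRank 𝒜 (q f) j (j + e) ↔ FullRank J f j e := by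
  refine or_congr ?_ ?_
  · constructor
    · intro h x hx hfx
      rw [← hq]
      refine h ((hmem j _).2 ⟨x, hx, rfl⟩) (zero_mem _) ?_
      change q f * q x = q f * 0
      rw [mul_zero, ← map_mul, hq]
      exact hfx
    · intro h z hz z' hz' hzz'
      obtain ⟨x, hx, rfl⟩ := (hmem j z).1 hz
      obtain ⟨x', hx', rfl⟩ := (hmem j z').1 hz'
      have hzz : q f * q x = q f * q x' := hzz'
      rw [← sub_eq_zero, ← map_sub, hq]
      refine h _ (hx.sub hx') ?_
      rw [← hq, map_mul, map_sub, mul_sub, hzz, sub_self]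
  · constructor
    · intro h y hy
      obtain ⟨z, hz, hzy⟩ := h ((hmem (j + e) _).2 ⟨y, hy, rfl⟩)
      obtain ⟨x, hx, rfl⟩ := (hmem j z).1 hz
      have hzy' : q f * q x = q y := hzy
      exact ⟨x, hx, by rw [← hq, map_sub, map_mul, hzy', sub_self]⟩
    · intro h z hz
      obtain ⟨y, hy, rfl⟩ := (hmem _ z).1 hz
      obtain ⟨x, hx, hxy⟩ := h y hy
      refine ⟨q x, (hmem j _).2 ⟨x, hx, rfl⟩, ?_⟩
      rw [← hq, map_sub, map_mul, sub_eq_zero] at hxy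
      exact hxy.symm

theorem mulFullRank_iff {I : Ideal (MvPolynomial (Fin l) K)} {s : ℕ → MvPolynomial (Fin l) K}
    {k : ℕ} {ℓ : Fin k → MvPolynomial (Fin l) K ⧸ I} (hℓ : ∀ j, ℓ j = Ideal.Quotient.mk I (s j))
    (i : Fin k) (j e : ℕ) :
    MulFullRank (quotientGrading (quotientGrading (homogeneousSubmodule (Fin l) K) I)
        (Ideal.span {x | ∃ j < i, ℓ j = x})) (Ideal.Quotient.mk _ (ℓ i) ^ e) j (j + e) ↔
      FullRank (seqIdeal I s i) (s i ^ e) j e := by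
  have hqi : Ideal.Quotient.mk (Ideal.span {x | ∃ j < i, ℓ j = x}) (ℓ i) ^ e =
      (Ideal.Quotient.mk (Ideal.span {x | ∃ j < i, ℓ j = x})).comp (Ideal.Quotient.mk I)
        (s i ^ e) := by
    rw [hℓ, map_pow]
    rfl
  rw [hqi]
  refine mulFullRank_iff_of_map _ (mk_mk_eq_zero_iff hℓ i) (fun t z => ?_) _ j e
  constructor
  · rintro ⟨_, ⟨x, hx, rfl⟩, rfl⟩
    exact ⟨x, hx, rfl⟩
  · rintro ⟨x, hx, rfl⟩
    exact ⟨_, ⟨x, hx, rfl⟩, rfl⟩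

/-- The Lefschetz properties of `S ⧸ I`, expressed in `S`. -/
theorem exists_mulFullRank_iff (I : Ideal (MvPolynomial (Fin l) K)) (Q : ℕ → Prop) (k : ℕ) :
    (∃ ℓ : Fin k → MvPolynomial (Fin l) K ⧸ I, ∀ i : Fin k,
        ℓ i ∈ quotientGrading (homogeneousSubmodule (Fin l) K) I 1 ∧ ∀ j e, Q e →
          MulFullRank (quotientGrading (quotientGrading (homogeneousSubmodule (Fin l) K) I)
            (Ideal.span {x | ∃ j < i, ℓ j = x})) (Ideal.Quotient.mk _ (ℓ i) ^ e) j (j + e)) ↔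
      ∃ s : ℕ → MvPolynomial (Fin l) K, (∀ p, (s p).IsHomogeneous 1) ∧
        ∀ i < k, ∀ j e, Q e → FullRank (seqIdeal I s i) (s i ^ e) j e := by
  constructor
  · rintro ⟨ℓ, hℓ⟩
    choose f hf hfℓ using fun i => (hℓ i).1
    -- The terms from `k` on never enter; `0` is an admissible linear form.
    let s : ℕ → MvPolynomial (Fin l) K := fun p => if h : p < k then f ⟨p, h⟩ else 0
    have hsℓ : ∀ j : Fin k, ℓ j = Ideal.Quotient.mk I (s j) := by
      intro j
      have : s j = f j := dif_pos j.2
      rw [this]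
      exact (hfℓ j).symm
    refine ⟨s, fun p => ?_, fun i hi j e he => ?_⟩
    · by_cases h : p < k
      · have : s p = f ⟨p, h⟩ := dif_pos h
        rw [this]
        exact hf _
      · have : s p = 0 := dif_neg h
        rw [this]
        exact isHomogeneous_zero _ _ _
    · exact (mulFullRank_iff hsℓ ⟨i, hi⟩ j e).1 ((hℓ ⟨i, hi⟩).2 j e he)
  · rintro ⟨s, hs, h⟩
    refine ⟨fun j => Ideal.Quotient.mk I (s j), fun i => ⟨⟨s i, hs i, rfl⟩, fun j e he => ?_⟩⟩
    exact (mulFullRank_iff (fun _ => rfl) i j e).2 (h i i.2 j e he)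

theorem hasKSLP_iff (I : Ideal (MvPolynomial (Fin l) K)) (k : ℕ) :
    HasKSLP (quotientGrading (homogeneousSubmodule (Fin l) K) I) k ↔
      ∃ s : ℕ → MvPolynomial (Fin l) K, (∀ p, (s p).IsHomogeneous 1) ∧
        ∀ i < k, ∀ j e, 1 ≤ e → FullRank (seqIdeal I s i) (s i ^ e) j e := by
  rw [← exists_mulFullRank_iff I (fun e => 1 ≤ e) k]
  refine exists_congr fun ℓ => forall_congr' fun i => and_congr_right fun h => ?_
  exact ⟨fun h' => h'.2, fun h' => ⟨⟨_, h, rfl⟩, h'⟩⟩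

theorem hasKWLP_iff (I : Ideal (MvPolynomial (Fin l) K)) (k : ℕ) :
    HasKWLP (quotientGrading (homogeneousSubmodule (Fin l) K) I) k ↔
      ∃ s : ℕ → MvPolynomial (Fin l) K, (∀ p, (s p).IsHomogeneous 1) ∧
        ∀ i < k, ∀ j e, e = 1 → FullRank (seqIdeal I s i) (s i ^ e) j e := by
  rw [← exists_mulFullRank_iff I (fun e => e = 1) k]
  refine exists_congr fun ℓ => forall_congr' fun i => and_congr_right fun h => ?_
  constructor
  · rintro h' j _ rfl
    rw [pow_one]
    exact h'.2 j
  · intro h'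
    refine ⟨⟨_, h, rfl⟩, fun j => ?_⟩
    have := h' j 1 rfl
    rwa [pow_one] at this

section Truncation

variable {I : Ideal (MvPolynomial (Fin l) K)} {r : ℕ}

theorem seqIdeal_sup_pow (s : ℕ → MvPolynomial (Fin l) K) (i : ℕ) :
    seqIdeal (I ⊔ idealOfVars (Fin l) K ^ r) s i =
      seqIdeal I s i ⊔ idealOfVars (Fin l) K ^ r := by
  rw [seqIdeal, seqIdeal, sup_right_comm]

theorem mem_sup_pow_iff {J : Ideal (MvPolynomial (Fin l) K)}
    (hJ : J.IsHomogeneous (homogeneousSubmodule (Fin l) K)) {t : ℕ} (ht : t < r)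
    {y : MvPolynomial (Fin l) K} (hy : y.IsHomogeneous t) :
    y ∈ J ⊔ idealOfVars (Fin l) K ^ r ↔ y ∈ J := by
  refine ⟨fun h => ?_, fun h => Ideal.mem_sup_left h⟩
  obtain ⟨a, ha, b, hb, rfl⟩ := Submodule.mem_sup.1 h
  have hb0 : intComponent (t : ℤ) b = 0 := by
    ext u
    rw [coeff_intComponent, coeff_zero]
    split_ifs with hu
    · exact (mem_pow_idealOfVars_iff' _ _).1 hb u (by
        have : u.degree = t := by exact_mod_cast hu
        omega)
    · rfl
  rw [← intComponent_of_mem (mem_intPiece_natCast.2 hy), map_add, hb0, add_zero]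
  exact intComponent_mem hJ ha _

/-- If the target degree is at most `r`, neither source nor target changes. Beyond `r` the target is
zero and the map is surjective. -/
theorem fullRank_sup_pow_iff {J : Ideal (MvPolynomial (Fin l) K)}
    (hJ : J.IsHomogeneous (homogeneousSubmodule (Fin l) K)) {f : MvPolynomial (Fin l) K} {e : ℕ}
    (hf : f.IsHomogeneous e) (j : ℕ) :
    FullRank (J ⊔ idealOfVars (Fin l) K ^ (r + 1)) f j e ↔ (j + e ≤ r → FullRank J f j e) := by
  rcases le_or_gt (j + e) r with h | h
  · have hmul : ∀ x : MvPolynomial (Fin l) K, x.IsHomogeneous j → (f * x).IsHomogeneous (j + e) :=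
      fun x hx => by
        rw [add_comm]
        exact hf.mul hx
    simp only [h, forall_const]
    refine or_congr ?_ ?_
    · refine forall_congr' fun x => forall_congr' fun hx => ?_
      rw [mem_sup_pow_iff hJ (by omega) hx, mem_sup_pow_iff hJ (by omega) (hmul x hx)]
    · refine forall_congr' fun y => forall_congr' fun hy => exists_congr fun x =>
        and_congr_right fun hx => ?_
      rw [mem_sup_pow_iff hJ (Nat.lt_succ_of_le h) (hy.sub (hmul x hx))]
  · refine ⟨fun _ h' => absurd h' (not_le.2 h), fun _ => Or.inr fun y hy => ⟨0, ?_, ?_⟩⟩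
    · exact isHomogeneous_zero _ _ _
    · rw [mul_zero, sub_zero]
      exact Ideal.mem_sup_right (isHomogeneous_mem_pow h hy)

theorem exists_fullRank_sup_pow_iff (hI : I.IsHomogeneous (homogeneousSubmodule (Fin l) K))
    (Q : ℕ → Prop) (k : ℕ) :
    (∃ s : ℕ → MvPolynomial (Fin l) K, (∀ p, (s p).IsHomogeneous 1) ∧ ∀ i < k, ∀ j e, Q e →
        FullRank (seqIdeal (I ⊔ idealOfVars (Fin l) K ^ (r + 1)) s i) (s i ^ e) j e) ↔
      ∃ s : ℕ → MvPolynomial (Fin l) K, (∀ p, (s p).IsHomogeneous 1) ∧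
        IsLefschetzUpTo I Q k r s := by
  refine exists_congr fun s => and_congr_right fun hs => ?_
  refine forall_congr' fun i => forall_congr' fun hi => forall_congr' fun j => forall_congr' fun e =>
    forall_congr' fun he => ?_
  rw [seqIdeal_sup_pow]
  exact fullRank_sup_pow_iff (isHomogeneous_seqIdeal hI hs i) (by simpa using (hs i).pow e) j

/-- The polynomials of degree at most `r` span the quotient, which is therefore finite-dimensional.
-/
theorem isArtinianRing_quotient_sup_pow :
    IsArtinianRing (MvPolynomial (Fin l) K ⧸ (I ⊔ idealOfVars (Fin l) K ^ (r + 1))) := by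
  set J := I ⊔ idealOfVars (Fin l) K ^ (r + 1) with hJ
  let W : Submodule K (MvPolynomial (Fin l) K) :=
    ⨆ t ∈ Finset.range (r + 1), homogeneousSubmodule (Fin l) K t
  have hW : W.FG := Submodule.fg_biSup _ _ fun t _ => homogeneousSubmodule_fg (Fin l) K t
  have hmap : W.map (Ideal.Quotient.mkₐ K J).toLinearMap = ⊤ := by
    rw [eq_top_iff]
    rintro z -
    obtain ⟨x, rfl⟩ := Ideal.Quotient.mk_surjective z
    refine ⟨∑ t ∈ Finset.range (r + 1), homogeneousComponent t x, ?_, ?_⟩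
    · refine Submodule.sum_mem _ fun t ht => ?_
      exact Submodule.mem_iSup_of_mem t (Submodule.mem_iSup_of_mem ht (homogeneousComponent_mem _ _))
    · refine Ideal.Quotient.eq.2 (Ideal.mem_sup_right ?_)
      rw [mem_pow_idealOfVars_iff']
      intro u hu
      rw [coeff_sub, coeff_sum]
      simp only [coeff_homogeneousComponent]
      rw [Finset.sum_ite_eq, if_pos (Finset.mem_range.2 hu), sub_self]
  have hfin : Module.Finite K (MvPolynomial (Fin l) K ⧸ J) := ⟨hmap ▸ hW.map _⟩
  exact IsArtinianRing.of_finite K _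

end Truncation

end Main

theorem theorem5p4 {K : Type*} [Field K] [CharZero K] {l k : ℕ} (hk : 1 ≤ k) (hkl : k ≤ l)
    (I : Ideal (MvPolynomial (Fin l) K))
    (hI : I.IsHomogeneous (homogeneousSubmodule (Fin l) K)) :
    IsArtinianRing (MvPolynomial (Fin l) K ⧸ hatIdeal I hI) ∧
      (HasKSLP (quotientGrading (homogeneousSubmodule (Fin l) K) I) k ↔
        HasKSLP (quotientGrading (homogeneousSubmodule (Fin l) K) (hatIdeal I hI)) k) ∧
      (HasKWLP (quotientGrading (homogeneousSubmodule (Fin l) K) I) k ↔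
        HasKWLP (quotientGrading (homogeneousSubmodule (Fin l) K) (hatIdeal I hI)) k) := by
  -- Characteristic zero enters only through the infinitude of `K`.
  have hinf : Infinite K := Infinite.of_injective (Nat.cast : ℕ → K) Nat.cast_injective
  -- `Q` is the set of exponents tested: all positive ones for the strong property, only `1` for the
  -- weak one. Closure under smaller positive exponents lets a power be cut at degree `r`.
  have key : ∀ Q : ℕ → Prop, Q 1 → (∀ e e', Q e → 1 ≤ e' → e' ≤ e → Q e') →
      ((∃ s : ℕ → MvPolynomial (Fin l) K, (∀ p, (s p).IsHomogeneous 1) ∧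
          ∀ i < k, ∀ j e, Q e → FullRank (seqIdeal I s i) (s i ^ e) j e) ↔
        ∃ s : ℕ → MvPolynomial (Fin l) K, (∀ p, (s p).IsHomogeneous 1) ∧
          ∀ i < k, ∀ j e, Q e → FullRank (seqIdeal (hatIdeal I hI) s i) (s i ^ e) j e) := by
    intro Q hQ1 hQ
    refine Iff.trans ?_ (exists_fullRank_sup_pow_iff hI Q k).symm
    constructor
    · rintro ⟨s, hs, h⟩
      exact ⟨s, hs, fun i hi j e he _ => h i hi j e he⟩
    · rintro ⟨s, hs, h⟩
      exact exists_fullRank_of_isLefschetzUpTo hI hQ1 hQ hkl hs h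
  refine ⟨isArtinianRing_quotient_sup_pow, ?_, ?_⟩
  · rw [hasKSLP_iff, hasKSLP_iff]
    exact key (fun e => 1 ≤ e) le_rfl fun _ _ _ h _ => h
  · rw [hasKWLP_iff, hasKWLP_iff]
    exact key (fun e => e = 1) rfl fun e e' h h1 h2 => by omega
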